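/- **Setting.** Let $T$ be an operad (coloured symmetric operad of sets) with object set $I$: it has sets of arrows $\alpha:(i_j)_{1\le j\le n}\to i$ with $i_j,i\in I$ and $n\ge 0$, functorial right actions $\alpha\mapsto\alpha\rho:(i_{\rho j})_j\to i$ of permutations $\rho\in\Sigma_n$, identities $1_i:(i)\to i$, and compositions $\alpha\circ(\beta_j)_j$ that are unital, associative and equivariant. *The 2-monad.* Regard $T$ as a 2-monad on $\mathbf{Cat}/I$. For $X\to I$, the objects of $TX$ are pairs $(\alpha,(x_j)_j)$ with $\alpha:(i_j)_j\to i$ in $T$ and $x_j\in X_{i_j}$, lying over $i$. An arrow $(\alpha,(x_j)_j)\to(\beta,(y_j)_j)$ is a pair $(\rho,(\gamma_j)_j)$ of a permutation $\rho$ with $\alpha=\beta\rho$ and arrows $\gamma_j:x_j\to y_{\rho j}$ of $X$. The unit is $x\mapsto(1_i,(x))$ for $x\in X_i$, and the multiplication is $(\alpha,(\alpha_j,(x_{jk})_k)_j)\mapsto(\alpha\circ(\alpha_j)_j,(x_{jk})_{jk})$, with the corresponding effects on arrows. *Lax morphisms $H:T\to\underline{\mathbf{Cat}}$.* Such an $H$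 consists of small categories $H_i$ $(i\in I)$, functors $H_\alpha:\prod_jH_{i_j}\to H_i$, and natural transformations with components $$\xi_{\alpha,\rho}:H_{\alpha\rho}(x_{\rho j})_j\to H_\alpha(x_j)_j,\qquad \nu_i:x\to H_{1_i}(x),\qquad \sigma_{\alpha,(\beta_j)}:H_\alpha\big(H_{\beta_j}(x_{jk})_k\big)_j\to H_{\alpha\circ(\beta_j)_j}(x_{jk})_{jk},$$ where $\xi$ is functorial in $\rho$, $\sigma$ is unital with respect to $\nu$, associative, and compatible with $\xi$. Let $\int H\to I$ be the object of $\mathbf{Cat}/I$ with fibres $H_i$. It carries the corresponding lax $T$-algebra structure. Its action $a:T\int H\to\int H$ has $a(\alpha,(x_j)_j)=H_\alpha(x_j)_j$ on objects, and on an arrow $(\rho,(\gamma_j)_j):(\alpha\rho,(x_j)_j)\to(\alpha,(y_j)_j)$ it is $\xi_{\alpha,\rho}\circ H_{\alpha\rho}(\gamma_j)_j$. Its coherence 2-cells $1\Rightarrow a\,\eta$ and $a\,T(a)\Rightarrow a\,\mu$ have as components those of $\nu$ and $\sigma$. *Transformations.* A lax-natural transformation $(f,\overline f):H\to K$ consists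 of functors $f_i:H_i\to K_i$ and natural transformations $\overline f_\alpha:K_\alpha(f_{i_j}x_j)_j\to f_iH_\alpha(x_j)_j$ compatible with $\xi$, $\nu$ and $\sigma$. A colax-natural transformation is defined in the same way with $\overline f_\alpha$ reversed. The functor $\int f:\int H\to\int K$ over $I$ with fibres $f_i$ is then the underlying arrow of the corresponding lax (resp. colax) morphism of $T$-algebras, whose coherence 2-cell $b\,T(\int f)\Rightarrow(\int f)\,a$ (resp. $(\int f)\,a\Rightarrow b\,T(\int f)$), where $b$ is the action on $\int K$, has at $(\alpha,(x_j)_j)$ the component of $\overline f_\alpha$ at $(x_j)_j$. *2-cells.* A modification $\psi:(f,\overline f)\to(g,\overline g)$ of lax-natural transformations is a family of natural transformations $\psi_i:f_i\to g_i$ $(i\in I)$ such that $(\psi_i\cdot H_\alpha)\,\overline f_\alpha=\overline g_\alpha\,\big(K_\alpha\cdot\prod_j\psi_{i_j}\big)$ for every $\alpha:(i_j)_j\to i$ in $T$; in the colax case the condition is $\big(K_\alpha\cdot\prod_j\psi_{i_j}\big)\,\overline f_\alpha=\overline g_\alpha\,(\psi_i\cdot H_\alpha)$. Let $F,G$ be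 two lax morphisms of lax $T$-algebras from $(A,a)$ to $(B,b)$, with coherence 2-cells $\overline F:b\,T(F)\Rightarrow F\,a$ and $\overline G:b\,T(G)\Rightarrow G\,a$. An algebra 2-cell $F\Rightarrow G$ is a 2-cell $\theta:F\Rightarrow G$ of $\mathbf{Cat}/I$ such that $(\theta\cdot a)\,\overline F=\overline G\,(b\cdot T\theta)$; for colax morphisms, with $\overline F:F\,a\Rightarrow b\,T(F)$ and $\overline G:G\,a\Rightarrow b\,T(G)$, the condition is $(b\cdot T\theta)\,\overline F=\overline G\,(\theta\cdot a)$. **Theorem.** Let $H,K:T\to\underline{\mathbf{Cat}}$ be lax morphisms of operads, and let $(f,\overline f),(g,\overline g):H\to K$ be lax-natural (resp. colax-natural) transformations. Then to give a modification $(f,\overline f)\to(g,\overline g)$ is to give an algebra 2-cell between the corresponding lax (resp. colax) morphisms of $T$-algebras. More precisely, the assignment $\psi=(\psi_i)_{i\in I}\mapsto\int\psi$, where $\int\psi:\int f\Rightarrow\int g$ is the 2-cell of $\mathbf{Cat}/I$ whose component at $x\in H_i$ is that of $\psi_i$, is a bijection from the set of modifications $(f,\overline f)\to(g,\overline g)$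 to the set of algebra 2-cells between the corresponding lax (resp. colax) morphisms of $T$-algebras. -/

import Mathlib

open CategoryTheory Bicategory

universe w v u

/-- A 2-monad on a 2-category. -/
structure TwoMonad (𝒦 : Type u) [Bicategory.{w, v} 𝒦] [Bicategory.Strict 𝒦] where
  /-- the underlying endo-2-functor -/
  T : StrictPseudofunctor 𝒦 𝒦
  /-- the unit -/
  η (A : 𝒦) : A ⟶ T.obj A
  /-- the multiplication -/
  μ (A : 𝒦) : T.obj (T.obj A) ⟶ T.obj A
  η_naturality {A B : 𝒦} (f : A ⟶ B) : f ≫ η B = η A ≫ T.map f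
  η_naturality₂ {A B : 𝒦} {f g : A ⟶ B} (θ : f ⟶ g) :
    θ ▷ η B = eqToHom (η_naturality f) ≫ η A ◁ T.map₂ θ ≫ eqToHom (η_naturality g).symm
  μ_naturality {A B : 𝒦} (f : A ⟶ B) : T.map (T.map f) ≫ μ B = μ A ≫ T.map f
  μ_naturality₂ {A B : 𝒦} {f g : A ⟶ B} (θ : f ⟶ g) :
    T.map₂ (T.map₂ θ) ▷ μ B =
      eqToHom (μ_naturality f) ≫ μ A ◁ T.map₂ θ ≫ eqToHom (μ_naturality g).symm
  η_μ (A : 𝒦) : η (T.obj A) ≫ μ A = 𝟙 (T.obj A)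
  map_η_μ (A : 𝒦) : T.map (η A) ≫ μ A = 𝟙 (T.obj A)
  μ_μ (A : 𝒦) : T.map (μ A) ≫ μ A = μ (T.obj A) ≫ μ A

namespace TwoMonad

variable {𝒦 : Type u} [Bicategory.{w, v} 𝒦] [Bicategory.Strict 𝒦] (M : TwoMonad 𝒦)

/-- A lax algebra structure on `A`. The 2-cells `eqToHom _` are identities: they only
record that the two sides agree by the laws of a 2-monad. -/
structure LaxAlgebra (A : 𝒦) where
  act : M.T.obj A ⟶ A
  unit : 𝟙 A ⟶ M.η A ≫ act
  mult : M.T.map act ≫ act ⟶ M.μ A ≫ act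
  unit_left :
    act ◁ unit ≫
      eqToHom (show act ≫ M.η A ≫ act = M.η (M.T.obj A) ≫ M.T.map act ≫ act by
        rw [← Strict.assoc, M.η_naturality, Strict.assoc]) ≫
      M.η (M.T.obj A) ◁ mult =
    eqToHom (show act ≫ 𝟙 A = M.η (M.T.obj A) ≫ M.μ A ≫ act by
        rw [← Strict.assoc, M.η_μ, Strict.id_comp, Strict.comp_id])
  unit_right :
    M.T.map₂ unit ▷ act ≫
      eqToHom (show M.T.map (M.η A ≫ act) ≫ act = M.T.map (M.η A) ≫ M.T.map act ≫ act by
        rw [M.T.map_comp, Strict.assoc]) ≫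
      M.T.map (M.η A) ◁ mult =
    eqToHom (show M.T.map (𝟙 A) ≫ act = M.T.map (M.η A) ≫ M.μ A ≫ act by
        rw [← Strict.assoc, M.map_η_μ, M.T.map_id])
  assoc :
    M.T.map (M.T.map act) ◁ mult ≫
      eqToHom (show M.T.map (M.T.map act) ≫ M.μ A ≫ act =
          M.μ (M.T.obj A) ≫ M.T.map act ≫ act by
        rw [← Strict.assoc, M.μ_naturality, Strict.assoc]) ≫
      M.μ (M.T.obj A) ◁ mult =
    eqToHom (show M.T.map (M.T.map act) ≫ M.T.map act ≫ act =
          M.T.map (M.T.map act ≫ act) ≫ act by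
        rw [← Strict.assoc, M.T.map_comp]) ≫
      M.T.map₂ mult ▷ act ≫
      eqToHom (show M.T.map (M.μ A ≫ act) ≫ act = M.T.map (M.μ A) ≫ M.T.map act ≫ act by
        rw [M.T.map_comp, Strict.assoc]) ≫
      M.T.map (M.μ A) ◁ mult ≫
      eqToHom (show M.T.map (M.μ A) ≫ M.μ A ≫ act = M.μ (M.T.obj A) ≫ M.μ A ≫ act by
        rw [← Strict.assoc, M.μ_μ, Strict.assoc])

variable {M} {A B : 𝒦}

/-- The structure of a lax morphism of lax algebras on `f : A ⟶ B`. -/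
structure LaxMorphism (a : M.LaxAlgebra A) (b : M.LaxAlgebra B) (f : A ⟶ B) where
  cell : M.T.map f ≫ b.act ⟶ a.act ≫ f
  unit :
    eqToHom (show f = f ≫ 𝟙 B from (Strict.comp_id f).symm) ≫ f ◁ b.unit ≫
      eqToHom (show f ≫ M.η B ≫ b.act = M.η A ≫ M.T.map f ≫ b.act by
        rw [← Strict.assoc, M.η_naturality, Strict.assoc]) ≫
      M.η A ◁ cell =
    eqToHom (show f = 𝟙 A ≫ f from (Strict.id_comp f).symm) ≫ a.unit ▷ f ≫
      eqToHom (Strict.assoc _ _ _)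
  mult :
    M.T.map (M.T.map f) ◁ b.mult ≫
      eqToHom (show M.T.map (M.T.map f) ≫ M.μ B ≫ b.act = M.μ A ≫ M.T.map f ≫ b.act by
        rw [← Strict.assoc, M.μ_naturality, Strict.assoc]) ≫
      M.μ A ◁ cell =
    eqToHom (show M.T.map (M.T.map f) ≫ M.T.map b.act ≫ b.act =
          M.T.map (M.T.map f ≫ b.act) ≫ b.act by
        rw [← Strict.assoc, M.T.map_comp]) ≫
      M.T.map₂ cell ▷ b.act ≫
      eqToHom (show M.T.map (a.act ≫ f) ≫ b.act = M.T.map a.act ≫ M.T.map f ≫ b.act by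
        rw [M.T.map_comp, Strict.assoc]) ≫
      M.T.map a.act ◁ cell ≫
      eqToHom (show M.T.map a.act ≫ a.act ≫ f = (M.T.map a.act ≫ a.act) ≫ f from
        (Strict.assoc _ _ _).symm) ≫
      a.mult ▷ f ≫
      eqToHom (Strict.assoc _ _ _)

/-- The structure of a colax morphism of lax algebras on `f : A ⟶ B`. -/
structure ColaxMorphism (a : M.LaxAlgebra A) (b : M.LaxAlgebra B) (f : A ⟶ B) where
  cell : a.act ≫ f ⟶ M.T.map f ≫ b.act
  unit :
    eqToHom (show f = 𝟙 A ≫ f from (Strict.id_comp f).symm) ≫ a.unit ▷ f ≫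
      eqToHom (Strict.assoc _ _ _) ≫ M.η A ◁ cell =
    eqToHom (show f = f ≫ 𝟙 B from (Strict.comp_id f).symm) ≫ f ◁ b.unit ≫
      eqToHom (show f ≫ M.η B ≫ b.act = M.η A ≫ M.T.map f ≫ b.act by
        rw [← Strict.assoc, M.η_naturality, Strict.assoc])
  mult :
    a.mult ▷ f ≫ eqToHom (Strict.assoc _ _ _) ≫ M.μ A ◁ cell =
    eqToHom (Strict.assoc _ _ _) ≫
      M.T.map a.act ◁ cell ≫
      eqToHom (show M.T.map a.act ≫ M.T.map f ≫ b.act = M.T.map (a.act ≫ f) ≫ b.act by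
        rw [M.T.map_comp, Strict.assoc]) ≫
      M.T.map₂ cell ▷ b.act ≫
      eqToHom (show M.T.map (M.T.map f ≫ b.act) ≫ b.act =
          M.T.map (M.T.map f) ≫ M.T.map b.act ≫ b.act by
        rw [M.T.map_comp, Strict.assoc]) ≫
      M.T.map (M.T.map f) ◁ b.mult ≫
      eqToHom (show M.T.map (M.T.map f) ≫ M.μ B ≫ b.act = M.μ A ≫ M.T.map f ≫ b.act by
        rw [← Strict.assoc, M.μ_naturality, Strict.assoc])

/-- Algebra 2-cells between lax morphisms. -/
structure LaxMorphism.TwoCell {a : M.LaxAlgebra A} {b : M.LaxAlgebra B} {f g : A ⟶ B}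
    (F : LaxMorphism a b f) (G : LaxMorphism a b g) where
  cell : f ⟶ g
  comm : F.cell ≫ a.act ◁ cell = M.T.map₂ cell ▷ b.act ≫ G.cell

/-- Algebra 2-cells between colax morphisms. -/
structure ColaxMorphism.TwoCell {a : M.LaxAlgebra A} {b : M.LaxAlgebra B} {f g : A ⟶ B}
    (F : ColaxMorphism a b f) (G : ColaxMorphism a b g) where
  cell : f ⟶ g
  comm : F.cell ≫ M.T.map₂ cell ▷ b.act = a.act ◁ cell ≫ G.cell

end TwoMonad

/-- An object of `Cat/I`, for `I` a set. -/
structure CatOver (I : Type u) where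
  carrier : Type u
  [cat : Category.{u} carrier]
  proj : carrier ⥤ Discrete I

namespace CatOver

attribute [instance] CatOver.cat

variable {I : Type u}

/-- A functor over `I`. -/
@[ext]
structure Hom (X Y : CatOver I) where
  functor : X.carrier ⥤ Y.carrier
  functor_proj : functor ⋙ Y.proj = X.proj

/-- A 2-cell of `Cat/I`: a natural transformation. As `I` is discrete, it automatically
lies over the identity of the projection to `I`. -/
@[ext]
structure TwoCell {X Y : CatOver I} (F G : Hom X Y) where
  nat : F.functor ⟶ G.functor

instance catStruct : CategoryStruct (CatOver I) where
  Hom := Hom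
  id X := ⟨𝟭 _, rfl⟩
  comp F G := ⟨F.functor ⋙ G.functor, by rw [Functor.assoc, G.functor_proj, F.functor_proj]⟩

instance homCat (X Y : CatOver I) : Category (X ⟶ Y) where
  Hom F G := TwoCell F G
  id F := ⟨𝟙 F.functor⟩
  comp α β := ⟨α.nat ≫ β.nat⟩
  id_comp _ := congrArg TwoCell.mk (Category.id_comp _)
  comp_id _ := congrArg TwoCell.mk (Category.comp_id _)
  assoc _ _ _ := congrArg TwoCell.mk (Category.assoc _ _ _)

/-- An invertible 2-cell from a natural isomorphism. -/
def isoMk {X Y : CatOver I} {F G : X ⟶ Y} (e : Hom.functor F ≅ Hom.functor G) : F ≅ G where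
  hom := ⟨e.hom⟩
  inv := ⟨e.inv⟩
  hom_inv_id := congrArg TwoCell.mk e.hom_inv_id
  inv_hom_id := congrArg TwoCell.mk e.inv_hom_id

/-- The component at `x` of a 2-cell. -/
def app {X Y : CatOver I} {F G : X ⟶ Y} (θ : F ⟶ G) (x : X.carrier) :
    (Hom.functor F).obj x ⟶ (Hom.functor G).obj x :=
  (TwoCell.nat θ).app x

theorem hom₂_ext {X Y : CatOver I} {F G : X ⟶ Y} {θ θ' : F ⟶ G}
    (h : ∀ x, app θ x = app θ' x) : θ = θ' :=
  TwoCell.ext (NatTrans.ext (funext h))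

instance : Bicategory (CatOver I) where
  toCategoryStruct := catStruct
  homCategory := homCat
  whiskerLeft F _ _ α := ⟨Functor.whiskerLeft (Hom.functor F) (TwoCell.nat α)⟩
  whiskerRight α G := ⟨Functor.whiskerRight (TwoCell.nat α) (Hom.functor G)⟩
  associator F G H := isoMk (Functor.associator (Hom.functor F) (Hom.functor G) (Hom.functor H))
  leftUnitor F := isoMk (Hom.functor F).leftUnitor
  rightUnitor F := isoMk (Hom.functor F).rightUnitor
  whiskerLeft_id _ _ := congrArg TwoCell.mk (Functor.whiskerLeft_id _)
  id_whiskerRight _ _ := congrArg TwoCell.mk (Functor.whiskerRight_id _)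
  whiskerLeft_comp _ _ _ _ _ _ := rfl
  id_whiskerLeft _ := by
    refine hom₂_ext fun x => ?_
    change _ = 𝟙 _ ≫ app _ x ≫ 𝟙 _
    rw [Category.id_comp, Category.comp_id]; rfl
  comp_whiskerLeft _ _ _ _ _ := by
    refine hom₂_ext fun x => ?_
    change _ = 𝟙 _ ≫ app _ _ ≫ 𝟙 _
    rw [Category.id_comp, Category.comp_id]; rfl
  comp_whiskerRight _ _ K := by
    refine hom₂_ext fun x => (Hom.functor K).map_comp _ _
  whiskerRight_id _ := by
    refine hom₂_ext fun x => ?_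
    change _ = 𝟙 _ ≫ app _ _ ≫ 𝟙 _
    rw [Category.id_comp, Category.comp_id]; rfl
  whiskerRight_comp _ _ _ := by
    refine hom₂_ext fun x => ?_
    change _ = 𝟙 _ ≫ (Hom.functor _).map ((Hom.functor _).map (app _ _)) ≫ 𝟙 _
    rw [Category.id_comp, Category.comp_id]; rfl
  whisker_assoc F _ _ θ H := by
    refine hom₂_ext fun x => ?_
    change _ = 𝟙 _ ≫ (Hom.functor H).map (app θ ((Hom.functor F).obj x)) ≫ 𝟙 _
    rw [Category.id_comp, Category.comp_id]; rfl
  whisker_exchange α β := by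
    refine hom₂_ext fun x => ?_
    exact ((TwoCell.nat β).naturality _).symm
  pentagon F G H K := by
    refine hom₂_ext fun x => ?_
    change (Hom.functor K).map (𝟙 _) ≫ 𝟙 _ ≫ 𝟙 _ = 𝟙 _ ≫ 𝟙 _
    simp
  triangle F G := by
    refine hom₂_ext fun x => ?_
    change 𝟙 _ ≫ 𝟙 _ = (Hom.functor G).map (𝟙 _)
    simp

instance : Bicategory.Strict (CatOver I) where
  id_comp _ := rfl
  comp_id _ := rfl
  assoc _ _ _ := rfl
  leftUnitor_eqToIso _ := by ext; rfl
  rightUnitor_eqToIso _ := by ext; rfl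
  associator_eqToIso _ _ _ := by ext; rfl

section

variable {X Y Z : CatOver I}

@[simp] theorem app_comp {F G H : X ⟶ Y} (θ : F ⟶ G) (θ' : G ⟶ H) (x : X.carrier) :
    app (θ ≫ θ') x = app θ x ≫ app θ' x := rfl

@[simp] theorem app_whiskerLeft (F : X ⟶ Y) {G H : Y ⟶ Z} (θ : G ⟶ H) (x : X.carrier) :
    app (F ◁ θ) x = app θ ((Hom.functor F).obj x) := rfl

@[simp] theorem app_whiskerRight {F G : X ⟶ Y} (θ : F ⟶ G) (H : Y ⟶ Z) (x : X.carrier) :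
    app (θ ▷ H) x = (Hom.functor H).map (app θ x) := rfl

@[simp] theorem app_eqToHom {F G : X ⟶ Y} (h : F = G) (x : X.carrier) :
    app (eqToHom h) x = eqToHom (by rw [h]) := by
  subst h; rfl

theorem hom₂_ext_heq {F G F' G' : X ⟶ Y} {θ : F ⟶ G} {θ' : F' ⟶ G'} (hF : F = F') (hG : G = G')
    (h : ∀ x, HEq (app θ x) (app θ' x)) : θ = eqToHom hF ≫ θ' ≫ eqToHom hG.symm := by
  subst hF hG
  rw [eqToHom_refl, Category.id_comp, eqToHom_refl, Category.comp_id]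
  exact hom₂_ext fun x => eq_of_heq (h x)

/-- The element of `I` over which an object lies. -/
def deg (X : CatOver I) (x : X.carrier) : I := (X.proj.obj x).as

theorem deg_eq (X : CatOver I) {x y : X.carrier} (f : x ⟶ y) : X.deg x = X.deg y :=
  Discrete.eq_of_hom (X.proj.map f)

theorem deg_map (F : X ⟶ Y) (x : X.carrier) : Y.deg ((Hom.functor F).obj x) = X.deg x :=
  congrArg (fun P : X.carrier ⥤ Discrete I => (P.obj x).as) (Hom.functor_proj F)

/-- A functor over `I` is a functor which preserves degrees. -/
def homMk (F : X.carrier ⥤ Y.carrier) (h : ∀ x, Y.deg (F.obj x) = X.deg x) : X ⟶ Y where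
  functor := F
  functor_proj := CategoryTheory.Functor.ext (fun x => Discrete.ext (h x)) fun _ _ _ => Subsingleton.elim _ _

theorem hom_ext {F G : X ⟶ Y} (h : Hom.functor F = Hom.functor G) : F = G := Hom.ext h

end

end CatOver

section Blocks

/-- The concatenation of a family of finite sequences, as a single sequence. -/
abbrev concat {n : ℕ} {m : Fin n → ℕ} {X : ∀ j, Fin (m j) → Sort v} (x : ∀ j k, X j k)
    (l : Fin (∑ j, m j)) : X (finSigmaFinEquiv.symm l).1 (finSigmaFinEquiv.symm l).2 :=
  x (finSigmaFinEquiv.symm l).1 (finSigmaFinEquiv.symm l).2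

/-- The bijection which permutes blocks by `e`, and the inside of the `j`-th block by `τ j`. -/
def blockEquiv {n n' : ℕ} {m : Fin n → ℕ} {m' : Fin n' → ℕ} (e : Fin n' ≃ Fin n)
    (τ : ∀ j, Fin (m' j) ≃ Fin (m (e j))) : Fin (∑ j, m' j) ≃ Fin (∑ j, m j) :=
  finSigmaFinEquiv.symm.trans ((Equiv.sigmaCongr e τ).trans finSigmaFinEquiv)

theorem symm_blockEquiv {n n' : ℕ} {m : Fin n → ℕ} {m' : Fin n' → ℕ} (e : Fin n' ≃ Fin n)
    (τ : ∀ j, Fin (m' j) ≃ Fin (m (e j))) (l : Fin (∑ j, m' j)) :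
    finSigmaFinEquiv.symm (blockEquiv e τ l) =
      ⟨e (finSigmaFinEquiv.symm l).1, τ _ (finSigmaFinEquiv.symm l).2⟩ := by
  simp [blockEquiv, Equiv.sigmaCongr]

/-- The lexicographic order on the positions of a family of finite sequences. -/
abbrev LexLT {n : ℕ} {m : Fin n → ℕ} : (Σ j, Fin (m j)) → (Σ j, Fin (m j)) → Prop :=
  Sigma.Lex (· < ·) (fun _ => (· < ·))

theorem finSigma_lt {n : ℕ} {m : Fin n → ℕ} {s t : Σ j, Fin (m j)} (h : LexLT s t) :
    finSigmaFinEquiv s < finSigmaFinEquiv t := by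
  rw [Fin.lt_def, finSigmaFinEquiv_apply, finSigmaFinEquiv_apply]
  cases h with
  | @left j j' k k' h =>
    have key : ∀ N (hN : N ≤ n), (j : ℕ) < N →
        ∑ i : Fin (j : ℕ), m (Fin.castLE j.2.le i) + k < ∑ i : Fin N, m (Fin.castLE hN i) := by
      intro N
      induction N with
      | zero => intro _ h; omega
      | succ N ih =>
        intro hN h
        rw [Fin.sum_univ_castSucc]
        rcases Nat.lt_succ_iff_lt_or_eq.1 h with h | h
        · exact lt_of_lt_of_le (ih (by omega) h) (Nat.le_add_right _ _)
        · subst h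
          exact Nat.add_lt_add_left k.2 _
    exact lt_of_lt_of_le (key _ j'.2.le h) (Nat.le_add_right _ _)
  | right k k' h => exact Nat.add_lt_add_left h _

theorem finSigma_symm_lt {n : ℕ} {m : Fin n → ℕ} {l l' : Fin (∑ j, m j)} (h : l < l') :
    LexLT (finSigmaFinEquiv.symm l) (finSigmaFinEquiv.symm l') := by
  rcases trichotomous_of LexLT (finSigmaFinEquiv.symm l) (finSigmaFinEquiv.symm l')
    with h1 | h1 | h1
  · exact h1
  · rw [finSigmaFinEquiv.symm.injective h1] at h
    exact absurd h (lt_irrefl _)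
  · have := finSigma_lt h1
    simp only [Equiv.apply_symm_apply] at this
    exact absurd h this.asymm

theorem val_eq_of_strictMono {a b : ℕ} (hab : a = b) {f : Fin a → Fin b} (h : StrictMono f)
    (i : Fin a) : (f i : ℕ) = i := by
  subst hab
  have : h.orderIsoOfSurjective f (Finite.injective_iff_surjective.1 h.injective) =
    OrderIso.refl _ := Subsingleton.elim _ _
  exact congrArg (fun f : Fin a ≃o Fin a => ((f i : Fin a) : ℕ)) this

theorem sum_concat {n : ℕ} {m : Fin n → ℕ} (p : ∀ j, Fin (m j) → ℕ) :
    ∑ l, concat p l = ∑ j, ∑ k, p j k := by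
  rw [← Fintype.sum_sigma' p]
  exact Fintype.sum_equiv finSigmaFinEquiv.symm _ _ fun _ => rfl

theorem lexLT_flatten {n : ℕ} {m : Fin n → ℕ} {p : ∀ j, Fin (m j) → ℕ} {s t : Σ j, Fin (m j)}
    (a : Fin (p s.1 s.2)) (b : Fin (p t.1 t.2)) (h : LexLT s t) :
    LexLT (⟨s.1, finSigmaFinEquiv ⟨s.2, a⟩⟩ : Σ j, Fin (∑ k, p j k))
      ⟨t.1, finSigmaFinEquiv ⟨t.2, b⟩⟩ := by
  cases h with
  | left _ _ h => exact .left _ _ h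
  | right _ _ h => exact .right _ _ (finSigma_lt (.left _ _ h))

/-- Concatenation of sequences is associative: the positions in a threefold concatenation do
not depend on the bracketing. -/
theorem position_assoc {n : ℕ} {m : Fin n → ℕ} {p : ∀ j, Fin (m j) → ℕ}
    (l : Fin (∑ l, concat p l)) (l' : Fin (∑ j, ∑ k, p j k)) (h : (l : ℕ) = l') :
    (⟨(finSigmaFinEquiv.symm (finSigmaFinEquiv.symm l).1).1,
      (finSigmaFinEquiv.symm (finSigmaFinEquiv.symm l).1).2, (finSigmaFinEquiv.symm l).2⟩ :
      Σ j, Σ k, Fin (p j k)) =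
    ⟨(finSigmaFinEquiv.symm l').1, finSigmaFinEquiv.symm (finSigmaFinEquiv.symm l').2⟩ := by
  let f : Fin (∑ l, concat p l) → Fin (∑ j, ∑ k, p j k) := fun l =>
    finSigmaFinEquiv ⟨(finSigmaFinEquiv.symm (finSigmaFinEquiv.symm l).1).1,
      finSigmaFinEquiv ⟨(finSigmaFinEquiv.symm (finSigmaFinEquiv.symm l).1).2,
        (finSigmaFinEquiv.symm l).2⟩⟩
  have hf : StrictMono f := by
    intro l₁ l₂ h
    have h1 := finSigma_symm_lt h
    dsimp only [f]
    apply finSigma_lt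
    generalize finSigmaFinEquiv.symm l₁ = s₁ at h1
    generalize finSigmaFinEquiv.symm l₂ = s₂ at h1
    cases h1 with
    | @left t₁ t₂ r₁ r₂ h1 =>
      exact lexLT_flatten _ _ (finSigma_symm_lt h1)
    | right _ _ h1 => exact .right _ _ (finSigma_lt (.right _ _ h1))
  have h2 : f l = l' := Fin.ext ((val_eq_of_strictMono (sum_concat p) hf l).trans h)
  rw [← h2]
  change _ = (fun s : Σ j, Fin (∑ k, p j k) =>
    (⟨s.1, finSigmaFinEquiv.symm s.2⟩ : Σ j, Σ k, Fin (p j k))) _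
  rw [Equiv.symm_apply_apply]
  simp only [Equiv.symm_apply_apply]

theorem position_assoc_iff {n : ℕ} {m : Fin n → ℕ} {p : ∀ j, Fin (m j) → ℕ}
    (l : Fin (∑ l, concat p l)) (l' : Fin (∑ j, ∑ k, p j k)) :
    (⟨(finSigmaFinEquiv.symm (finSigmaFinEquiv.symm l).1).1,
      (finSigmaFinEquiv.symm (finSigmaFinEquiv.symm l).1).2, (finSigmaFinEquiv.symm l).2⟩ :
      Σ j, Σ k, Fin (p j k)) =
    ⟨(finSigmaFinEquiv.symm l').1, finSigmaFinEquiv.symm (finSigmaFinEquiv.symm l').2⟩ ↔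
      (l : ℕ) = l' := by
  refine ⟨fun h => ?_, position_assoc l l'⟩
  have h1 := position_assoc l (Fin.cast (sum_concat p) l) rfl
  rw [h1] at h
  have h2 := congrArg (fun s : Σ j, Σ k, Fin (p j k) =>
    finSigmaFinEquiv (⟨s.1, finSigmaFinEquiv s.2⟩ : Σ j, Fin (∑ k, p j k))) h
  simp only [Equiv.apply_symm_apply, Sigma.eta] at h2
  rw [← h2]
  rfl

theorem position_one {n : ℕ} (l : Fin (∑ _ : Fin 1, n)) :
    ((finSigmaFinEquiv.symm l).2 : ℕ) = l := by
  obtain ⟨s, rfl⟩ := finSigmaFinEquiv.surjective l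
  rw [Equiv.symm_apply_apply, finSigmaFinEquiv_one]

theorem position_ones {n : ℕ} (l : Fin (∑ _ : Fin n, 1)) :
    ((finSigmaFinEquiv.symm l).1 : ℕ) = l := by
  obtain ⟨⟨j, k⟩, rfl⟩ := finSigmaFinEquiv.surjective l
  rw [Equiv.symm_apply_apply, finSigmaFinEquiv_apply]
  simp

end Blocks

/-- An operad (coloured symmetric operad of sets, symmetric multicategory) with object set `I`.

The permutation action is written for bijections `e : Fin m ≃ Fin n`. Since such a bijection
exists only if `m = n`, this is precisely an action of the symmetric groups (a functor to sets
on the opposite of the category of natural numbers and permutations). Equalities between arrows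
whose sources are only propositionally equal sequences are stated in the set of all arrows. -/
structure OperadData (I : Type u) where
  /-- the arrows with source `c 0, ..., c (n - 1)` and target `i` -/
  Hom {n : ℕ} (c : Fin n → I) (i : I) : Type u
  /-- the arrow `αρ` -/
  perm {m n : ℕ} {c : Fin n → I} {i : I} (α : Hom c i) (ρ : Fin m ≃ Fin n) :
    Hom (fun k => c (ρ k)) i
  /-- the identity arrows -/
  one (i : I) : Hom (fun _ : Fin 1 => i) i
  /-- composition -/
  comp {n : ℕ} {c : Fin n → I} {i : I} (α : Hom c i) {m : Fin n → ℕ}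
    {d : ∀ j, Fin (m j) → I} (β : ∀ j, Hom (d j) (c j)) : Hom (concat d) i

/-- An arrow of `T`, with its source and target. -/
@[ext]
structure OperadData.Arrow {I : Type u} (T : OperadData I) where
  arity : ℕ
  src : Fin arity → I
  tgt : I
  hom : T.Hom src tgt

/-- An arrow regarded as an element of the set of all arrows. -/
abbrev OperadData.arr {I : Type u} (T : OperadData I) {n : ℕ} {c : Fin n → I} {i : I}
    (α : T.Hom c i) : T.Arrow :=
  ⟨n, c, i, α⟩

structure Operad (I : Type u) extends OperadData I where
  perm_refl {n : ℕ} {c : Fin n → I} {i : I} (α : Hom c i) : perm α (Equiv.refl _) = α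
  perm_perm {l m n : ℕ} {c : Fin n → I} {i : I} (α : Hom c i) (ρ₁ : Fin m ≃ Fin n)
    (ρ₂ : Fin l ≃ Fin m) : perm (perm α ρ₁) ρ₂ = perm α (ρ₂.trans ρ₁)
  one_comp {n : ℕ} {c : Fin n → I} {i : I} (α : Hom c i) :
    toOperadData.arr (comp (one i) fun _ => α) = toOperadData.arr α
  comp_one {n : ℕ} {c : Fin n → I} {i : I} (α : Hom c i) :
    toOperadData.arr (comp α fun j => one (c j)) = toOperadData.arr α
  comp_comp {n : ℕ} {c : Fin n → I} {i : I} (α : Hom c i) {m : Fin n → ℕ}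
    {d : ∀ j, Fin (m j) → I} (β : ∀ j, Hom (d j) (c j)) {p : ∀ j, Fin (m j) → ℕ}
    {b : ∀ j k, Fin (p j k) → I} (γ : ∀ j k, Hom (b j k) (d j k)) :
    toOperadData.arr (comp (comp α β) (concat γ)) =
      toOperadData.arr (comp α fun j => comp (β j) (γ j))
  comp_perm {n n' : ℕ} {c : Fin n → I} {i : I} (α : Hom c i) {m : Fin n → ℕ}
    {d : ∀ j, Fin (m j) → I} (β : ∀ j, Hom (d j) (c j)) {m' : Fin n' → ℕ}
    (ρ : Fin n' ≃ Fin n) (τ : ∀ j, Fin (m' j) ≃ Fin (m (ρ j))) :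
    toOperadData.arr (comp (perm α ρ) fun j => perm (β (ρ j)) (τ j)) =
      toOperadData.arr (perm (comp α β) (blockEquiv ρ τ))

namespace Operad

variable {I : Type u} (T : Operad I)

variable {T} in
/-- The arrow `αρ`, in the set of all arrows. -/
def arrPerm (α : T.Arrow) {m : ℕ} (ρ : Fin m ≃ Fin α.arity) : T.Arrow :=
  T.arr (T.perm α.hom ρ)

variable {T} in
/-- Composition in the set of all arrows. -/
def arrComp (α : T.Arrow) (β : Fin α.arity → T.Arrow) (h : ∀ j, (β j).tgt = α.src j) : T.Arrow :=
  T.arr (T.comp α.hom fun j => h j ▸ (β j).hom)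

theorem arrow_mk_eq {T : Operad I} {n : ℕ} {c c' : Fin n → I} {i i' : I} {a : T.Hom c i}
    {a' : T.Hom c' i'} (h : T.arr a = T.arr a') : c = c' ∧ i = i' ∧ HEq a a' := by
  simpa [OperadData.Arrow.mk.injEq] using h

theorem arrow_eq_trans_aux {T : Operad I} {α γ : T.Arrow} {n : ℕ} {c : Fin n → I} {i : I}
    {b : T.Hom c i} {ρ : Fin α.arity ≃ Fin n} {τ : Fin n ≃ Fin γ.arity}
    (h : α = arrPerm (T.arr b) ρ) (h' : T.arr b = arrPerm γ τ) :
    α = arrPerm γ (ρ.trans τ) := by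
  refine h.trans ?_
  clear h
  obtain ⟨rfl, rfl, hb⟩ := arrow_mk_eq h'
  obtain rfl := eq_of_heq hb
  simp only [arrPerm, T.perm_perm]
  rfl

theorem arrow_eq_trans {T : Operad I} {α β γ : T.Arrow} {ρ : Fin α.arity ≃ Fin β.arity}
    {τ : Fin β.arity ≃ Fin γ.arity} (h : α = arrPerm β ρ) (h' : β = arrPerm γ τ) :
    α = arrPerm γ (ρ.trans τ) :=
  arrow_eq_trans_aux (b := β.hom) h h'

theorem arrPerm_refl {T : Operad I} (α : T.Arrow) : arrPerm α (Equiv.refl _) = α := by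
  simp [arrPerm, T.perm_refl]

theorem arrComp_aux {T : Operad I} {n : ℕ} {c : Fin n → I} {i : I} {a : T.Hom c i} {n' : ℕ} {c' : Fin n' → I} {i' : I}
    {a' : T.Hom c' i'} {ρ : Fin n ≃ Fin n'}
    {m : Fin n → ℕ} {d : ∀ j, Fin (m j) → I} {t : Fin n → I}
    {b : ∀ j, T.Hom (d j) (t j)} {β' : Fin n' → T.Arrow}
    (h : ∀ j, t j = c j) (h' : ∀ j, (β' j).tgt = c' j)
    {τ : ∀ j, Fin (m j) ≃ Fin (β' (ρ j)).arity}
    (hα : T.arr a = arrPerm (T.arr a') ρ) (hβ : ∀ j, T.arr (b j) = arrPerm (β' (ρ j)) (τ j)) :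
    arrComp (T.arr a) (fun j => T.arr (b j)) h =
      arrPerm (arrComp (T.arr a') β' h') (blockEquiv ρ τ) := by
  obtain rfl : c' = fun j => (β' j).tgt := funext fun j => (h' j).symm
  obtain rfl : d = fun j k => (β' (ρ j)).src (τ j k) := funext fun j => (arrow_mk_eq (hβ j)).1
  obtain rfl : t = fun j => (β' (ρ j)).tgt := funext fun j => (arrow_mk_eq (hβ j)).2.1
  obtain rfl : b = fun j => T.perm (β' (ρ j)).hom (τ j) :=
    funext fun j => eq_of_heq (arrow_mk_eq (hβ j)).2.2
  obtain ⟨rfl, rfl, ha⟩ := arrow_mk_eq hα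
  obtain rfl := eq_of_heq ha
  exact T.comp_perm a' (fun j => (β' j).hom) ρ τ

theorem arrComp_arrow_eq {T : Operad I} {α α' : T.Arrow} {ρ : Fin α.arity ≃ Fin α'.arity}
    {β : Fin α.arity → T.Arrow} {β' : Fin α'.arity → T.Arrow}
    (h : ∀ j, (β j).tgt = α.src j) (h' : ∀ j, (β' j).tgt = α'.src j)
    {τ : ∀ j, Fin (β j).arity ≃ Fin (β' (ρ j)).arity}
    (hα : α = arrPerm α' ρ) (hβ : ∀ j, β j = arrPerm (β' (ρ j)) (τ j)) :
    arrComp α β h = arrPerm (arrComp α' β' h') (blockEquiv ρ τ) :=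
  arrComp_aux (a := α.hom) (a' := α'.hom) (b := fun j => (β j).hom) h h' hα hβ

theorem arrComp_ones {T : Operad I} (α : T.Arrow) {t : Fin α.arity → I}
    (h : ∀ j, t j = α.src j) : arrComp α (fun j => T.arr (T.one (t j))) h = α := by
  obtain rfl : t = α.src := funext h
  exact T.comp_one α.hom

theorem arrComp_assoc_aux {T : Operad I} {n : ℕ} {c : Fin n → I} {i : I} (a : T.Hom c i)
    {m : Fin n → ℕ} {t : Fin n → I} {d : ∀ j, Fin (m j) → I} (b : ∀ j, T.Hom (d j) (t j))
    (γ : ∀ j, Fin (m j) → T.Arrow) (h : ∀ j, t j = c j) (h' : ∀ j k, (γ j k).tgt = d j k) :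
    arrComp (arrComp (T.arr a) (fun j => T.arr (b j)) h) (concat γ) (fun _ => h' _ _) =
      arrComp (T.arr a) (fun j => arrComp (T.arr (b j)) (γ j) (h' j)) h := by
  obtain rfl : t = c := funext h
  obtain rfl : (fun j k => (γ j k).tgt) = d := funext fun j => funext (h' j)
  exact T.comp_comp a b fun j k => (γ j k).hom

theorem arrComp_assoc {T : Operad I} (α : T.Arrow) (β : Fin α.arity → T.Arrow)
    (γ : ∀ j, Fin (β j).arity → T.Arrow) (h : ∀ j, (β j).tgt = α.src j)
    (h' : ∀ j k, (γ j k).tgt = (β j).src k) :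
    arrComp (arrComp α β h) (concat γ) (fun _ => h' _ _) =
      arrComp α (fun j => arrComp (β j) (γ j) (h' j)) h :=
  arrComp_assoc_aux α.hom (fun j => (β j).hom) γ h h'

variable {T} {X Y Z : CatOver I}

variable (T) in
/-- An operation of `T` labelled in `X`. -/
structure Labelled (X : CatOver I) where
  arrow : T.Arrow
  label : Fin arrow.arity → X.carrier
  deg_label : ∀ j, X.deg (label j) = arrow.src j

namespace Labelled

/-- A morphism of labelled operations. -/
structure Hom (z w : Labelled T X) where
  perm : Fin z.arrow.arity ≃ Fin w.arrow.arity
  arrow_eq : z.arrow = arrPerm w.arrow perm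
  map : ∀ j, z.label j ⟶ w.label (perm j)

theorem ext {z w : Labelled T X} (h : z.arrow = w.arrow)
    (h' : ∀ (j : Fin z.arrow.arity) (k : Fin w.arrow.arity), (j : ℕ) = k → z.label j = w.label k) : z = w := by
  obtain ⟨α, x, hx⟩ := z
  obtain ⟨β, y, hy⟩ := w
  dsimp only at h
  subst h
  obtain rfl : x = y := funext fun j => h' j j rfl
  rfl

theorem Hom.ext {z w : Labelled T X} {f g : Hom z w} (h : ∀ j, f.perm j = g.perm j)
    (h' : ∀ j, HEq (f.map j) (g.map j)) : f = g := by
  obtain ⟨p, hp, f⟩ := f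
  obtain ⟨q, hq, g⟩ := g
  obtain rfl : p = q := Equiv.ext h
  obtain rfl : f = g := funext fun j => eq_of_heq (h' j)
  rfl

instance : Category (Labelled T X) where
  Hom := Hom
  id z := ⟨Equiv.refl _, by simp [arrPerm, T.perm_refl], fun _ => 𝟙 _⟩
  comp f g := ⟨f.perm.trans g.perm, by
    exact arrow_eq_trans f.arrow_eq g.arrow_eq, fun j => f.map j ≫ g.map (f.perm j)⟩
  id_comp f := Hom.ext (fun _ => rfl) fun _ => heq_of_eq (Category.id_comp _)
  comp_id f := Hom.ext (fun _ => rfl) fun _ => heq_of_eq (Category.comp_id _)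
  assoc f g h := Hom.ext (fun _ => rfl) fun _ => heq_of_eq (Category.assoc _ _ _)

theorem Hom.tgt_eq {z w : Labelled T X} (f : z ⟶ w) : z.arrow.tgt = w.arrow.tgt :=
  show z.arrow.tgt = (arrPerm w.arrow (Hom.perm f)).tgt from
    congrArg OperadData.Arrow.tgt (Hom.arrow_eq f)

theorem hom_heq {z z' w w' : Labelled T X} (hz : z = z') (hw : w = w') {f : z ⟶ w} {g : z' ⟶ w'}
    (h : ∀ (j : Fin z.arrow.arity) (k : Fin z'.arrow.arity), (j : ℕ) = k →
      (Hom.perm f j : ℕ) = Hom.perm g k)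
    (h' : ∀ (j : Fin z.arrow.arity) (k : Fin z'.arrow.arity), (j : ℕ) = k →
      HEq (Hom.map f j) (Hom.map g k)) : HEq f g := by
  subst hz hw
  exact heq_of_eq (Hom.ext (fun j => Fin.ext (h j j rfl)) fun j => h' j j rfl)

theorem eqToHom_perm {z w : Labelled T X} (h : z = w) (j : Fin z.arrow.arity) :
    (Hom.perm (eqToHom h) j : ℕ) = j := by
  subst h; rfl

theorem eqToHom_map {z w : Labelled T X} (h : z = w) (j : Fin z.arrow.arity) :
    HEq (Hom.map (eqToHom h) j) (𝟙 (z.label j)) := by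
  subst h; rfl

theorem comp_eqToHom_map {z w w' : Labelled T X} (f : z ⟶ w) (h : w = w')
    (j : Fin z.arrow.arity) : HEq (Hom.map (f ≫ eqToHom h) j) (Hom.map f j) := by
  subst h
  rw [eqToHom_refl, Category.comp_id]

theorem comp_eqToHom_perm {ι : Type v} {w : ι → Labelled T X} {s t : ι} (hst : s = t)
    {z : Labelled T X} (f : z ⟶ w t) (h : w t = w s) (j : Fin z.arrow.arity) :
    (⟨s, Hom.perm (f ≫ eqToHom h) j⟩ : Σ s, Fin (w s).arrow.arity) = ⟨t, Hom.perm f j⟩ := by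
  subst hst
  rw [eqToHom_refl, Category.comp_id]

end Labelled

/-- The category `TX` of operations of `T` labelled in `X`, over `I` by taking targets. -/
abbrev obj (T : Operad I) (X : CatOver I) : CatOver I where
  carrier := Labelled T X
  proj :=
    { obj := fun z => ⟨z.arrow.tgt⟩
      map := fun f => Discrete.eqToHom (Labelled.Hom.tgt_eq f) }

/-- The effect of `T` on arrows of `Cat/I`. -/
def map (T : Operad I) (F : X ⟶ Y) : T.obj X ⟶ T.obj Y :=
  CatOver.homMk
    { obj := fun z => ⟨z.arrow, fun j => (CatOver.Hom.functor F).obj (z.label j), fun j =>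
        (CatOver.deg_map F _).trans (z.deg_label j)⟩
      map := fun f => ⟨f.perm, f.arrow_eq, fun j => (CatOver.Hom.functor F).map (f.map j)⟩
      map_id := fun _ => Labelled.Hom.ext (fun _ => rfl) fun _ =>
        heq_of_eq ((CatOver.Hom.functor F).map_id _)
      map_comp := fun _ _ => Labelled.Hom.ext (fun _ => rfl) fun _ =>
        heq_of_eq ((CatOver.Hom.functor F).map_comp _ _) }
    fun _ => rfl

/-- The effect of `T` on 2-cells of `Cat/I`. -/
def map₂ (T : Operad I) {F G : X ⟶ Y} (θ : F ⟶ G) : T.map F ⟶ T.map G where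
  nat :=
    { app := fun z => ⟨Equiv.refl _, (arrPerm_refl _).symm, fun j => CatOver.app θ (z.label j)⟩
      naturality := fun _ _ f => Labelled.Hom.ext (fun _ => rfl) fun j =>
        heq_of_eq ((CatOver.TwoCell.nat θ).naturality (f.map j)) }

/-- The endo-2-functor of `Cat/I` given by `T`. -/
def functor (T : Operad I) : StrictPseudofunctor (CatOver I) (CatOver I) :=
  StrictPseudofunctor.mk''
    { obj := T.obj
      map := T.map
      map₂ := T.map₂
      map₂_id := fun _ => CatOver.hom₂_ext fun _ => rfl
      map₂_comp := fun _ _ => CatOver.hom₂_ext fun _ => rfl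
      map_id := fun _ => rfl
      map_comp := fun _ _ => rfl
      map₂_whisker_left := fun F _ _ θ => by
        exact ((Category.id_comp _).trans (Category.comp_id _)).symm
      map₂_whisker_right := fun θ G => by
        exact ((Category.id_comp _).trans (Category.comp_id _)).symm }

end Operad

namespace Operad

variable {I : Type u} {T : Operad I} {X Y Z : CatOver I}

/-- Functors into a category of labelled operations agree when they agree on underlying arrows,
labels, permutations and morphisms of labels. -/
theorem functor_ext {C : Type u} [Category.{u} C] {F G : C ⥤ Labelled T X}
    (h₁ : ∀ x, (F.obj x).arrow = (G.obj x).arrow)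
    (h₂ : ∀ x (j : Fin (F.obj x).arrow.arity) (k : Fin (G.obj x).arrow.arity), (j : ℕ) = k →
      (F.obj x).label j = (G.obj x).label k)
    (h₃ : ∀ x y (f : x ⟶ y) (j : Fin (F.obj x).arrow.arity) (k : Fin (G.obj x).arrow.arity),
      (j : ℕ) = k → (Labelled.Hom.perm (F.map f) j : ℕ) = Labelled.Hom.perm (G.map f) k)
    (h₄ : ∀ x y (f : x ⟶ y) (j : Fin (F.obj x).arrow.arity) (k : Fin (G.obj x).arrow.arity),
      (j : ℕ) = k → HEq (Labelled.Hom.map (F.map f) j) (Labelled.Hom.map (G.map f) k)) :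
    F = G :=
  CategoryTheory.Functor.hext (fun x => Labelled.ext (h₁ x) (h₂ x)) fun x y f =>
    Labelled.hom_heq (Labelled.ext (h₁ x) (h₂ x)) (Labelled.ext (h₁ y) (h₂ y)) (h₃ x y f) (h₄ x y f)

/-- The unit of the 2-monad `T`. -/
def η (T : Operad I) (X : CatOver I) : X ⟶ T.obj X :=
  CatOver.homMk
    { obj := fun x => ⟨T.arr (T.one (X.deg x)), fun _ => x, fun _ => rfl⟩
      map := fun f => ⟨Equiv.refl _, (congrArg (fun i => T.arr (T.one i)) (X.deg_eq f)).trans (arrPerm_refl _).symm, fun _ => f⟩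
      map_id := fun _ => rfl
      map_comp := fun _ _ => rfl }
    fun _ => rfl

/-- The multiplication of the 2-monad `T` on objects. -/
def μObj (z : Labelled T (T.obj X)) : Labelled T X where
  arrow := arrComp z.arrow (fun j => (z.label j).arrow) z.deg_label
  label := concat fun j => (z.label j).label
  deg_label _ := (z.label _).deg_label _

/-- The multiplication of the 2-monad `T` on arrows. -/
def μMap {z w : Labelled T (T.obj X)} (f : z ⟶ w) : μObj z ⟶ μObj w where
  perm := blockEquiv f.perm fun j => Labelled.Hom.perm (f.map j)
  arrow_eq := arrComp_arrow_eq _ _ f.arrow_eq fun j => Labelled.Hom.arrow_eq (f.map j)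
  map l := Labelled.Hom.map (f.map _) _ ≫ eqToHom
    (show (w.label (f.perm (finSigmaFinEquiv.symm l).1)).label
        (Labelled.Hom.perm (f.map _) (finSigmaFinEquiv.symm l).2) =
      concat (fun j => (w.label j).label) (blockEquiv f.perm _ l) 
      from congrArg (fun s : Σ j, Fin (w.label j).arrow.arity => (w.label s.1).label s.2)
        (symm_blockEquiv f.perm (fun j => Labelled.Hom.perm (f.map j)) l).symm)

theorem congr_position {n : ℕ} {m : Fin n → ℕ} {A : ∀ j, Fin (m j) → Sort v}
    (F : ∀ j k, A j k) {s t : Σ j, Fin (m j)} (h : s = t) : HEq (F s.1 s.2) (F t.1 t.2) := by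
  subst h; rfl

/-- The position of an input of `μObj z`. -/
def pos (z : Labelled T (T.obj X)) (l : Fin (μObj z).arrow.arity) :
    Σ j : Fin z.arrow.arity, Fin (z.label j).arrow.arity :=
  finSigmaFinEquiv.symm l

theorem pos_injective (z : Labelled T (T.obj X)) : Function.Injective (pos z) :=
  finSigmaFinEquiv.symm.injective

theorem μMap_position {z w : Labelled T (T.obj X)} (f : z ⟶ w) (l : Fin (μObj z).arrow.arity) :
    pos w (Labelled.Hom.perm (μMap f) l) =
      ⟨f.perm (pos z l).1, Labelled.Hom.perm (f.map _) (pos z l).2⟩ :=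
  symm_blockEquiv (m := fun j => (w.label j).arrow.arity) (m' := fun j => (z.label j).arrow.arity)
    f.perm (fun j => Labelled.Hom.perm (f.map j)) l

theorem μMap_map_heq {z w : Labelled T (T.obj X)} (f : z ⟶ w) (l : Fin (μObj z).arrow.arity) :
    HEq (Labelled.Hom.map (μMap f) l) (Labelled.Hom.map (f.map (pos z l).1) (pos z l).2) :=
  comp_eqToHom_heq _ _

theorem μMap_comp_position {z w v : Labelled T (T.obj X)} (f : z ⟶ w) (g : w ⟶ v)
    (l : Fin (μObj z).arrow.arity) :
    pos v (Labelled.Hom.perm (μMap g) (Labelled.Hom.perm (μMap f) l)) =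
      ⟨g.perm (f.perm (pos z l).1), Labelled.Hom.perm (g.map _)
        (Labelled.Hom.perm (f.map _) (pos z l).2)⟩ :=
  (μMap_position g _).trans <| congrArg (fun s : Σ j, Fin (w.label j).arrow.arity =>
    (⟨g.perm s.1, Labelled.Hom.perm (g.map s.1) s.2⟩ : Σ j, Fin (v.label j).arrow.arity))
    (μMap_position f l)

theorem μMap_comp {z w v : Labelled T (T.obj X)} (f : z ⟶ w) (g : w ⟶ v) :
    μMap (f ≫ g) = μMap f ≫ μMap g :=
  Labelled.Hom.ext
    (fun l => pos_injective _
      ((μMap_position (f ≫ g) l).trans (μMap_comp_position f g l).symm))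
    fun l => by
      refine (μMap_map_heq _ _).trans ?_
      refine heq_comp rfl
        (congrArg (fun s : Σ j, Fin (w.label j).arrow.arity => (w.label s.1).label s.2)
          (μMap_position f l)).symm
        (congrArg (fun s : Σ j, Fin (v.label j).arrow.arity => (v.label s.1).label s.2)
          (μMap_comp_position f g l)).symm (μMap_map_heq f l).symm ?_
      refine HEq.trans ?_ (μMap_map_heq g _).symm
      exact congr_position (fun j k => Labelled.Hom.map (g.map j) k) (μMap_position f l).symm

/-- The multiplication of the 2-monad `T`. -/
def μ (T : Operad I) (X : CatOver I) : T.obj (T.obj X) ⟶ T.obj X :=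
  CatOver.homMk
    { obj := μObj
      map := μMap
      map_id := fun _ => Labelled.Hom.ext
        (fun _ => pos_injective _ (μMap_position _ _))
        fun _ => μMap_map_heq _ _
      map_comp := μMap_comp }
    fun _ => rfl

theorem functor_map_heq {C D : Type u} [Category.{u} C] [Category.{u} D] (F : C ⥤ D)
    {x y x' y' : C} (hx : x = x') (hy : y = y') {f : x ⟶ y} {g : x' ⟶ y'} (h : HEq f g) :
    HEq (F.map f) (F.map g) := by
  subst hx hy
  rw [eq_of_heq h]

/-- The position of an input of a threefold composite, bracketed to the left. -/
def posL (z : Labelled T (T.obj (T.obj X)))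
    (l : Fin (((T.μ (T.obj X)) ≫ (T.μ X)).functor.obj z).arrow.arity) :
    Σ j : Fin z.arrow.arity, Σ k : Fin (z.label j).arrow.arity,
      Fin ((z.label j).label k).arrow.arity :=
  let s := pos (μObj z) l
  ⟨(pos z s.1).1, (pos z s.1).2, s.2⟩

/-- The position of an input of a threefold composite, bracketed to the right. -/
def posR (z : Labelled T (T.obj (T.obj X)))
    (l : Fin ((T.map (T.μ X) ≫ (T.μ X)).functor.obj z).arrow.arity) :
    Σ j : Fin z.arrow.arity, Σ k : Fin (z.label j).arrow.arity,
      Fin ((z.label j).label k).arrow.arity :=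
  let s := pos ((T.map (T.μ X)).functor.obj z) l
  ⟨s.1, pos (z.label s.1) s.2⟩

theorem posL_eq_posR_iff (z : Labelled T (T.obj (T.obj X)))
    (l : Fin (((T.μ (T.obj X)) ≫ (T.μ X)).functor.obj z).arrow.arity)
    (l' : Fin ((T.map (T.μ X) ≫ (T.μ X)).functor.obj z).arrow.arity) :
    posL z l = posR z l' ↔ (l : ℕ) = l' :=
  position_assoc_iff (p := fun j k => ((z.label j).label k).arrow.arity) l l'

/-- The effect of a morphism on positions. -/
def mapPos {z w : Labelled T (T.obj (T.obj X))} (f : z ⟶ w)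
    (s : Σ j : Fin z.arrow.arity, Σ k : Fin (z.label j).arrow.arity,
      Fin ((z.label j).label k).arrow.arity) :
    Σ j : Fin w.arrow.arity, Σ k : Fin (w.label j).arrow.arity,
      Fin ((w.label j).label k).arrow.arity :=
  ⟨f.perm s.1, Labelled.Hom.perm (f.map s.1) s.2.1,
    Labelled.Hom.perm (Labelled.Hom.map (f.map s.1) s.2.1) s.2.2⟩

theorem posR_map {z w : Labelled T (T.obj (T.obj X))} (f : z ⟶ w)
    (l : Fin ((T.map (T.μ X) ≫ (T.μ X)).functor.obj z).arrow.arity) :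
    posR w (Labelled.Hom.perm ((T.map (T.μ X) ≫ (T.μ X)).functor.map f) l) =
      mapPos f (posR z l) := by
  refine (congrArg (fun s : Σ j : Fin w.arrow.arity, Fin (μObj (w.label j)).arrow.arity =>
    (⟨s.1, pos (w.label s.1) s.2⟩ : Σ j : Fin w.arrow.arity, Σ k : Fin (w.label j).arrow.arity,
      Fin ((w.label j).label k).arrow.arity))
    (μMap_position ((T.map (T.μ X)).functor.map f) l)).trans ?_
  exact congrArg (Sigma.mk _) (μMap_position (f.map _) _)

theorem posL_map {z w : Labelled T (T.obj (T.obj X))} (f : z ⟶ w)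
    (l : Fin (((T.μ (T.obj X)) ≫ (T.μ X)).functor.obj z).arrow.arity) :
    posL w (Labelled.Hom.perm (((T.μ (T.obj X)) ≫ (T.μ X)).functor.map f) l) =
      mapPos f (posL z l) := by
  refine (congrArg (fun s : Σ j : Fin (μObj w).arrow.arity, Fin ((μObj w).label j).arrow.arity =>
    (⟨(pos w s.1).1, (pos w s.1).2, s.2⟩ : Σ j : Fin w.arrow.arity,
      Σ k : Fin (w.label j).arrow.arity, Fin ((w.label j).label k).arrow.arity))
    (μMap_position (μMap f) l)).trans ?_
  exact congrArg (fun s : Σ s : (Σ j : Fin w.arrow.arity, Fin (w.label j).arrow.arity),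
      Fin ((w.label s.1).label s.2).arrow.arity => (⟨s.1.1, s.1.2, s.2⟩ : Σ j : Fin w.arrow.arity,
      Σ k : Fin (w.label j).arrow.arity, Fin ((w.label j).label k).arrow.arity))
    (Labelled.comp_eqToHom_perm
      (w := fun s : Σ j : Fin w.arrow.arity, Fin (w.label j).arrow.arity => (w.label s.1).label s.2)
      (μMap_position f _) _ _ _)

theorem η_naturality (F : X ⟶ Y) : F ≫ T.η Y = T.η X ≫ T.map F := CatOver.hom_ext <| functor_ext
    (fun x => congrArg (fun i => T.arr (T.one i)) (CatOver.deg_map F x)) (fun _ _ _ _ => rfl)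
    (fun _ _ _ _ _ h => h) (fun _ _ _ _ _ _ => HEq.rfl)

theorem μ_naturality (F : X ⟶ Y) : T.map (T.map F) ≫ T.μ Y = T.μ X ≫ T.map F := CatOver.hom_ext <| functor_ext (fun _ => rfl)
    (fun _ _ _ h => by obtain rfl := Fin.ext h; rfl)
    (fun _ _ _ _ _ h => by obtain rfl := Fin.ext h; rfl)
    (fun z w f j k h => by
      obtain rfl := Fin.ext h
      refine (μMap_map_heq _ _).trans ?_
      exact functor_map_heq F.functor rfl
        (congrArg (fun s : Σ j, Fin (w.label j).arrow.arity => (w.label s.1).label s.2)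
          (μMap_position f j).symm) (μMap_map_heq f j).symm)

/-- The 2-monad on `Cat/I` associated to an operad with object set `I`. -/
def twoMonad (T : Operad I) : TwoMonad (CatOver I) where
  T := T.functor
  η := T.η
  μ := T.μ
  η_naturality := η_naturality
  η_naturality₂ {_ _ F G} θ := CatOver.hom₂_ext_heq (η_naturality F) (η_naturality G) fun x => Labelled.hom_heq
    (Labelled.ext (congrArg (fun i => T.arr (T.one i)) (CatOver.deg_map _ x)) fun _ _ _ => rfl)
    (Labelled.ext (congrArg (fun i => T.arr (T.one i)) (CatOver.deg_map _ x)) fun _ _ _ => rfl)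
    (fun _ _ h => h) fun _ _ _ => HEq.rfl
  μ_naturality := μ_naturality
  μ_naturality₂ {_ _ F G} θ := CatOver.hom₂_ext_heq (μ_naturality F) (μ_naturality G) fun z => Labelled.hom_heq rfl rfl
    (fun j k h => congrArg Fin.val ((pos_injective _ (μMap_position _ j)).trans (Fin.ext h)))
    fun j k h => by
      obtain rfl := Fin.ext h
      exact μMap_map_heq _ _
  η_μ X := CatOver.hom_ext <| functor_ext (fun z => T.one_comp z.arrow.hom)
    (fun z j k h => congrArg z.label (Fin.ext ((position_one j).trans h)))
    (fun z w f j k h => by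
      have h1 := congrArg (fun s => (s.2 : ℕ)) (μMap_position ((T.η (T.obj X)).functor.map f) j)
      refine (position_one _).symm.trans (h1.trans ?_)
      exact congrArg (fun k => (Labelled.Hom.perm f k : ℕ)) (Fin.ext ((position_one j).trans h)))
    (fun z w f j k h => by
      refine (μMap_map_heq _ _).trans ?_
      have : (pos ((T.η (T.obj X)).functor.obj z) j).2 = k := Fin.ext ((position_one j).trans h)
      subst this
      rfl)
  map_η_μ X := CatOver.hom_ext <| functor_ext (fun z => arrComp_ones z.arrow z.deg_label)
    (fun z j k h => congrArg z.label (Fin.ext ((position_ones j).trans h)))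
    (fun z w f j k h => by
      have h1 := congrArg (fun s => (s.1 : ℕ)) (μMap_position ((T.map (T.η X)).functor.map f) j)
      refine (position_ones _).symm.trans (h1.trans ?_)
      exact congrArg (fun k => (Labelled.Hom.perm f k : ℕ)) (Fin.ext ((position_ones j).trans h)))
    (fun z w f j k h => by
      refine (μMap_map_heq _ _).trans ?_
      have : (pos ((T.map (T.η X)).functor.obj z) j).1 = k := Fin.ext ((position_ones j).trans h)
      subst this
      rfl)
  μ_μ X := CatOver.hom_ext <| functor_ext
    (fun z => (arrComp_assoc z.arrow (fun j => (z.label j).arrow)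
      (fun j k => ((z.label j).label k).arrow) z.deg_label fun j => (z.label j).deg_label).symm)
    (fun z j k h => congrArg (fun s : Σ j : Fin z.arrow.arity, Σ k : Fin (z.label j).arrow.arity,
      Fin ((z.label j).label k).arrow.arity => ((z.label s.1).label s.2.1).label s.2.2)
      ((posL_eq_posR_iff z k j).2 h.symm).symm)
    (fun z w f j k h => by
      refine ((posL_eq_posR_iff w _ _).1 ?_).symm
      exact (posL_map f k).trans ((congrArg (mapPos f) ((posL_eq_posR_iff z k j).2 h.symm)).trans
        (posR_map f j).symm))
    (fun z w f j k h => by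
      refine (μMap_map_heq _ _).trans (HEq.trans ?_ (μMap_map_heq _ _).symm)
      refine (μMap_map_heq _ _).trans (HEq.trans ?_ (Labelled.comp_eqToHom_map _ _ _).symm)
      have h1 : posL z k = posR z j := (posL_eq_posR_iff z k j).2 h.symm
      change HEq (Labelled.Hom.map (Labelled.Hom.map (f.map (posR z j).1) (posR z j).2.1)
        (posR z j).2.2) (Labelled.Hom.map (Labelled.Hom.map (f.map (posL z k).1) (posL z k).2.1)
        (posL z k).2.2)
      rw [h1])

end Operad

section Families

variable {I : Type u} (C : I → Cat.{u, u})

/-- The isomorphism of a product of products with the product over all positions. -/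
abbrev concatFunctor {n : ℕ} {m : Fin n → ℕ} (d : ∀ j, Fin (m j) → I) :
    (∀ j k, C (d j k)) ⥤ ∀ l, C (concat d l) :=
  Functor.pi' fun l => Pi.eval (fun j => ∀ k, C (d j k)) (finSigmaFinEquiv.symm l).1 ⋙
    Pi.eval (fun k => C (d (finSigmaFinEquiv.symm l).1 k)) (finSigmaFinEquiv.symm l).2

/-- The identification of a category with a product with one factor. -/
abbrev singleFunctor (i : I) : C i ⥤ (Fin 1 → C i) :=
  Functor.pi' fun _ => 𝟭 (C i)

variable {C} {T : Operad I}

theorem prod_congr (P : ∀ {n : ℕ} {c : Fin n → I} {i : I}, T.Hom c i → (∀ j, C (c j)) ⥤ C i)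
    {n n' : ℕ} {c : Fin n → I} {c' : Fin n' → I} {i : I} {α : T.Hom c i} {α' : T.Hom c' i}
    {x : ∀ j, C (c j)} {x' : ∀ j, C (c' j)} (h : T.arr α = T.arr α')
    (hx : ∀ (j : Fin n) (k : Fin n'), (j : ℕ) = k → HEq (x j) (x' k)) :
    (P α).obj x = (P α').obj x' := by
  obtain rfl : n = n' := congrArg (fun a => a.arity) h
  obtain ⟨rfl, -, h⟩ := Operad.arrow_mk_eq h
  obtain rfl := eq_of_heq h
  obtain rfl : x = x' := funext fun j => eq_of_heq (hx j j rfl)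
  rfl

theorem congr_index {n : ℕ} {A : Fin n → Sort v} (x : ∀ j, A j) {j k : Fin n}
    (h : (j : ℕ) = k) : HEq (x j) (x k) := by
  obtain rfl := Fin.ext h
  rfl

theorem congr_blockEquiv {n n' : ℕ} {m : Fin n → ℕ} {m' : Fin n' → ℕ} {A : ∀ j, Fin (m j) → Sort v}
    (x : ∀ j k, A j k) (ρ : Fin n' ≃ Fin n) (τ : ∀ j, Fin (m' j) ≃ Fin (m (ρ j)))
    {l l' : Fin (∑ j, m' j)} (h : (l : ℕ) = l') :
    HEq (concat (fun j k => x (ρ j) (τ j k)) l) (concat x (blockEquiv ρ τ l')) := by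
  obtain rfl := Fin.ext h
  exact Operad.congr_position x (symm_blockEquiv ρ τ l).symm

theorem congr_assoc {n : ℕ} {m : Fin n → ℕ} {p : ∀ j, Fin (m j) → ℕ}
    {A : ∀ j k, Fin (p j k) → Sort v} (x : ∀ j k r, A j k r)
    {l : Fin (∑ l, concat p l)} {l' : Fin (∑ j, ∑ k, p j k)} (h : (l : ℕ) = l') :
    HEq (concat (m := concat p) (concat x) l) (concat (fun j => concat (x j)) l') := by
  have := position_assoc l l' h
  have key : ∀ {s t : Σ j, Σ k, Fin (p j k)}, s = t →
      HEq (x s.1 s.2.1 s.2.2) (x t.1 t.2.1 t.2.2) := by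
    rintro s _ rfl
    rfl
  exact key this

end Families

open Operad in
/-- A lax morphism of operads `T → Cat`. Axioms are stated on components; the morphisms
`eqToHom _` are identities, which record that two composites in `T` agree. -/
structure LaxOperadMorphism {I : Type u} (T : Operad I) where
  obj : I → Cat.{u, u}
  /-- products -/
  prod {n : ℕ} {c : Fin n → I} {i : I} (α : T.Hom c i) : (∀ j, obj (c j)) ⥤ obj i
  /-- symmetries -/
  ξ {m n : ℕ} {c : Fin n → I} {i : I} (α : T.Hom c i) (ρ : Fin m ≃ Fin n) :
    Pi.comap (fun j => obj (c j)) ρ ⋙ prod (T.perm α ρ) ⟶ prod α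
  /-- units -/
  ν (i : I) : 𝟭 (obj i) ⟶ singleFunctor obj i ⋙ prod (T.one i)
  /-- substitutions -/
  σ {n : ℕ} {c : Fin n → I} {i : I} (α : T.Hom c i) {m : Fin n → ℕ}
    {d : ∀ j, Fin (m j) → I} (β : ∀ j, T.Hom (d j) (c j)) :
    Functor.pi (fun j => prod (β j)) ⋙ prod α ⟶ concatFunctor obj d ⋙ prod (T.comp α β)
  ξ_refl {n : ℕ} {c : Fin n → I} {i : I} (α : T.Hom c i) (x : ∀ j, obj (c j)) :
    (ξ α (Equiv.refl _)).app x = eqToHom (prod_congr prod (congrArg T.arr (T.perm_refl α))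
      fun _ _ => congr_index x)
  ξ_trans {l m n : ℕ} {c : Fin n → I} {i : I} (α : T.Hom c i) (ρ₁ : Fin m ≃ Fin n)
    (ρ₂ : Fin l ≃ Fin m) (x : ∀ j, obj (c j)) :
    (ξ α (ρ₂.trans ρ₁)).app x =
      eqToHom (prod_congr prod (congrArg T.arr (T.perm_perm α ρ₁ ρ₂).symm)
        fun _ _ => congr_index fun j => x (ρ₁ (ρ₂ j))) ≫
      (ξ (T.perm α ρ₁) ρ₂).app (fun j => x (ρ₁ j)) ≫ (ξ α ρ₁).app x
  σ_one {n : ℕ} {c : Fin n → I} {i : I} (α : T.Hom c i) (x : ∀ j, obj (c j)) :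
    (prod α).map (fun j => (ν (c j)).app (x j)) ≫ (σ α fun j => T.one (c j)).app (fun j _ => x j) =
      eqToHom (prod_congr prod (T.comp_one α).symm
        fun _ _ h => congr_index x (h.trans (position_ones _).symm))
  one_σ {n : ℕ} {c : Fin n → I} {i : I} (α : T.Hom c i) (x : ∀ j, obj (c j)) :
    (ν i).app ((prod α).obj x) ≫ (σ (T.one i) fun _ => α).app (fun _ => x) =
      eqToHom (prod_congr prod (T.one_comp α).symm
        fun _ _ h => congr_index x (h.trans (position_one _).symm))
  σ_ξ {n n' : ℕ} {c : Fin n → I} {i : I} (α : T.Hom c i) {m : Fin n → ℕ}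
    {d : ∀ j, Fin (m j) → I} (β : ∀ j, T.Hom (d j) (c j)) {m' : Fin n' → ℕ}
    (ρ : Fin n' ≃ Fin n) (τ : ∀ j, Fin (m' j) ≃ Fin (m (ρ j))) (x : ∀ j k, obj (d j k)) :
    (σ (T.perm α ρ) fun j => T.perm (β (ρ j)) (τ j)).app (fun j k => x (ρ j) (τ j k)) ≫
      eqToHom (prod_congr prod (T.comp_perm α β ρ τ) fun _ _ => congr_blockEquiv x ρ τ) ≫
      (ξ (T.comp α β) (blockEquiv ρ τ)).app (concat x) =
    (prod (T.perm α ρ)).map (fun j => (ξ (β (ρ j)) (τ j)).app (x (ρ j))) ≫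
      (ξ α ρ).app (fun j => (prod (β j)).obj (x j)) ≫ (σ α β).app x
  σ_σ {n : ℕ} {c : Fin n → I} {i : I} (α : T.Hom c i) {m : Fin n → ℕ}
    {d : ∀ j, Fin (m j) → I} (β : ∀ j, T.Hom (d j) (c j)) {p : ∀ j, Fin (m j) → ℕ}
    {b : ∀ j k, Fin (p j k) → I} (γ : ∀ j k, T.Hom (b j k) (d j k)) (x : ∀ j k r, obj (b j k r)) :
    (σ α β).app (fun j k => (prod (γ j k)).obj (x j k)) ≫
      (σ (T.comp α β) (concat γ)).app (concat x) ≫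
      eqToHom (prod_congr prod (T.comp_comp α β γ) fun _ _ => congr_assoc x) =
    (prod α).map (fun j => (σ (β j) (γ j)).app (x j)) ≫
      (σ α fun j => T.comp (β j) (γ j)).app (fun j => concat (x j))

namespace LaxOperadMorphism

variable {I : Type u} {T : Operad I}

/-- A lax-natural transformation. -/
structure LaxNatTrans (H K : LaxOperadMorphism T) where
  functor (i : I) : H.obj i ⥤ K.obj i
  cell {n : ℕ} {c : Fin n → I} {i : I} (α : T.Hom c i) :
    Functor.pi (fun j => functor (c j)) ⋙ K.prod α ⟶ H.prod α ⋙ functor i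
  cell_ξ {m n : ℕ} {c : Fin n → I} {i : I} (α : T.Hom c i) (ρ : Fin m ≃ Fin n)
    (x : ∀ j, H.obj (c j)) :
    (cell (T.perm α ρ)).app (fun j => x (ρ j)) ≫ (functor i).map ((H.ξ α ρ).app x) =
      (K.ξ α ρ).app (fun j => (functor (c j)).obj (x j)) ≫ (cell α).app x
  cell_ν (i : I) (x : H.obj i) :
    (K.ν i).app ((functor i).obj x) ≫ (cell (T.one i)).app (fun _ => x) =
      (functor i).map ((H.ν i).app x)
  cell_σ {n : ℕ} {c : Fin n → I} {i : I} (α : T.Hom c i) {m : Fin n → ℕ}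
    {d : ∀ j, Fin (m j) → I} (β : ∀ j, T.Hom (d j) (c j)) (x : ∀ j k, H.obj (d j k)) :
    (K.σ α β).app (fun j k => (functor (d j k)).obj (x j k)) ≫
        (cell (T.comp α β)).app (concat x) =
      (K.prod α).map (fun j => (cell (β j)).app (x j)) ≫
        (cell α).app (fun j => (H.prod (β j)).obj (x j)) ≫ (functor i).map ((H.σ α β).app x)

/-- A colax-natural transformation. -/
structure ColaxNatTrans (H K : LaxOperadMorphism T) where
  functor (i : I) : H.obj i ⥤ K.obj i
  cell {n : ℕ} {c : Fin n → I} {i : I} (α : T.Hom c i) :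
    H.prod α ⋙ functor i ⟶ Functor.pi (fun j => functor (c j)) ⋙ K.prod α
  cell_ξ {m n : ℕ} {c : Fin n → I} {i : I} (α : T.Hom c i) (ρ : Fin m ≃ Fin n)
    (x : ∀ j, H.obj (c j)) :
    (cell (T.perm α ρ)).app (fun j => x (ρ j)) ≫
        (K.ξ α ρ).app (fun j => (functor (c j)).obj (x j)) =
      (functor i).map ((H.ξ α ρ).app x) ≫ (cell α).app x
  cell_ν (i : I) (x : H.obj i) :
    (functor i).map ((H.ν i).app x) ≫ (cell (T.one i)).app (fun _ => x) =
      (K.ν i).app ((functor i).obj x)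
  cell_σ {n : ℕ} {c : Fin n → I} {i : I} (α : T.Hom c i) {m : Fin n → ℕ}
    {d : ∀ j, Fin (m j) → I} (β : ∀ j, T.Hom (d j) (c j)) (x : ∀ j k, H.obj (d j k)) :
    (functor i).map ((H.σ α β).app x) ≫ (cell (T.comp α β)).app (concat x) =
      (cell α).app (fun j => (H.prod (β j)).obj (x j)) ≫
        (K.prod α).map (fun j => (cell (β j)).app (x j)) ≫
        (K.σ α β).app (fun j k => (functor (d j k)).obj (x j k))

variable {H K : LaxOperadMorphism T}

/-- A modification between lax-natural transformations. -/
@[ext]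
structure LaxNatTrans.Modification (f g : LaxNatTrans H K) where
  app (i : I) : f.functor i ⟶ g.functor i
  comm {n : ℕ} {c : Fin n → I} {i : I} (α : T.Hom c i) (x : ∀ j, H.obj (c j)) :
    (f.cell α).app x ≫ (app i).app ((H.prod α).obj x) =
      (K.prod α).map (fun j => (app (c j)).app (x j)) ≫ (g.cell α).app x

/-- A modification between colax-natural transformations. -/
@[ext]
structure ColaxNatTrans.Modification (f g : ColaxNatTrans H K) where
  app (i : I) : f.functor i ⟶ g.functor i
  comm {n : ℕ} {c : Fin n → I} {i : I} (α : T.Hom c i) (x : ∀ j, H.obj (c j)) :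
    (f.cell α).app x ≫ (K.prod α).map (fun j => (app (c j)).app (x j)) =
      (app i).app ((H.prod α).obj x) ≫ (g.cell α).app x

end LaxOperadMorphism

namespace LaxOperadMorphism

open Sigma Operad

section Fibres

variable {I : Type u} {C : I → Cat.{u, u}}

theorem fst_eq {z w : Σ i, C i} : (z ⟶ w) → z.1 = w.1
  | SigmaHom.mk _ => rfl

/-- An object of the disjoint union of the `C i`, regarded as an object of one of the fibres. -/
def fib (z : Σ i, C i) {i : I} (h : z.1 = i) : C i := h ▸ z.2

/-- An arrow of the disjoint union of the `C i`, regarded as an arrow of one of the fibres. -/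
def fibMap : ∀ {z w : Σ i, C i} (_ : z ⟶ w) {i : I} (h : z.1 = i) (h' : w.1 = i),
    (fib z h ⟶ fib w h')
  | _, _, SigmaHom.mk g, _, rfl, _ => g

theorem hom_cases {i : I} {y : C i} {z : Σ i, C i} (f : z ⟶ ⟨i, y⟩) :
    ∃ (x : C i) (g : x ⟶ y), (⟨z, f⟩ : Σ z : (Σ i, C i), (z ⟶ ⟨i, y⟩)) =
      ⟨⟨i, x⟩, SigmaHom.mk g⟩ := by
  obtain ⟨g⟩ := f
  exact ⟨_, g, rfl⟩

end Fibres

variable {I : Type u} {T : Operad I} (H K : LaxOperadMorphism T)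

/-- The object of `Cat/I` with fibres the categories `H i`. -/
abbrev total : CatOver I where
  carrier := Σ i, H.obj i
  proj :=
    { obj := fun z => ⟨z.1⟩
      map := fun f => Discrete.eqToHom (fst_eq f) }

/-- The inclusion of a fibre. -/
abbrev inc (i : I) : H.obj i ⥤ H.total.carrier := Sigma.incl (C := fun i => H.obj i) i

/-- The value of the action at a labelled operation. -/
def actObj (z : Labelled T H.total) : H.total.carrier :=
  ⟨z.arrow.tgt, (H.prod z.arrow.hom).obj fun j => fib (z.label j) (z.deg_label j)⟩

theorem actObj_eq_aux {m : ℕ} {d : Fin m → I} {i : I} {a : T.Hom d i} {x : Fin m → Σ i, H.obj i}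
    {hx : ∀ j, (x j).1 = d j} {w : T.Arrow} {ρ : Fin m ≃ Fin w.arity}
    (h : T.arr a = arrPerm w ρ) (h' : ∀ j, (x j).1 = w.src (ρ j)) :
    H.actObj ⟨T.arr a, x, hx⟩ =
      ⟨w.tgt, (H.prod (T.perm w.hom ρ)).obj fun j => fib (x j) (h' j)⟩ := by
  obtain ⟨rfl, rfl, ha⟩ := arrow_mk_eq h
  obtain rfl := eq_of_heq ha
  rfl

theorem actObj_eq {z w : Labelled T H.total} {ρ : Fin z.arrow.arity ≃ Fin w.arrow.arity}
    (h : z.arrow = arrPerm w.arrow ρ) (h' : ∀ j, (z.label j).1 = w.arrow.src (ρ j)) :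
    H.actObj z =
      ⟨w.arrow.tgt, (H.prod (T.perm w.arrow.hom ρ)).obj fun j => fib (z.label j) (h' j)⟩ :=
  H.actObj_eq_aux (a := z.arrow.hom) (hx := z.deg_label) h h'

/-- The value of the action at a morphism of labelled operations. -/
def actMap {z w : Labelled T H.total} (f : z ⟶ w) : H.actObj z ⟶ H.actObj w :=
  have h (j : Fin z.arrow.arity) : (z.label j).1 = w.arrow.src (f.perm j) :=
    (fst_eq (f.map j)).trans (w.deg_label _)
  eqToHom (H.actObj_eq f.arrow_eq h) ≫
    (H.inc _).map ((H.prod (T.perm w.arrow.hom f.perm)).map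
        (fun j => fibMap (f.map j) (h j) (w.deg_label _)) ≫
      (H.ξ w.arrow.hom f.perm).app fun j => fib (w.label j) (w.deg_label j))

section Standard

variable {H}

/-- A labelled operation. -/
abbrev lab {n : ℕ} {c : Fin n → I} {i : I} (α : T.Hom c i) (x : ∀ j, H.obj (c j)) :
    Labelled T H.total :=
  ⟨T.arr α, fun j => ⟨c j, x j⟩, fun _ => rfl⟩

/-- A morphism of labelled operations. -/
abbrev labHom {m n : ℕ} {c : Fin n → I} {i : I} (α : T.Hom c i) (ρ : Fin m ≃ Fin n)
    {x : ∀ j, H.obj (c (ρ j))} {y : ∀ j, H.obj (c j)} (g : ∀ j, x j ⟶ y (ρ j)) :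
    lab (T.perm α ρ) x ⟶ lab α y :=
  ⟨ρ, rfl, fun j => (H.inc _).map (g j)⟩

theorem lab_cases_aux {n : ℕ} {c : Fin n → I} {i : I} (α : T.Hom c i) (x : Fin n → Σ i, H.obj i)
    (hx : ∀ j, (x j).1 = c j) : ∃ x' : ∀ j, H.obj (c j),
      (⟨T.arr α, x, hx⟩ : Labelled T H.total) = lab α x' := by
  obtain rfl : (fun j => (x j).1) = c := funext hx
  exact ⟨fun j => (x j).2, rfl⟩

theorem exists_lab (z : Labelled T H.total) :
    ∃ (n : ℕ) (c : Fin n → I) (i : I) (α : T.Hom c i) (x : ∀ j, H.obj (c j)), z = lab α x :=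
  ⟨_, _, _, z.arrow.hom, lab_cases_aux z.arrow.hom z.label z.deg_label⟩

theorem lab_cases {P : Labelled T H.total → Prop}
    (std : ∀ {n : ℕ} {c : Fin n → I} {i : I} (α : T.Hom c i) (x : ∀ j, H.obj (c j)), P (lab α x))
    (z : Labelled T H.total) : P z := by
  obtain ⟨n, c, i, α, x, rfl⟩ := exists_lab z
  exact std α x

theorem labHom_cases_aux {n : ℕ} {c : Fin n → I} {i : I} {α : T.Hom c i} {y : ∀ j, H.obj (c j)}
    {m : ℕ} {d : Fin m → I} {i' : I} {a : T.Hom d i'} {x : Fin m → Σ i, H.obj i}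
    {hx : ∀ j, (x j).1 = d j} (ρ : Fin m ≃ Fin n) (e : T.arr a = T.arr (T.perm α ρ))
    (g : ∀ j, x j ⟶ ⟨c (ρ j), y (ρ j)⟩) :
    ∃ (x' : ∀ j, H.obj (c (ρ j))) (g' : ∀ j, x' j ⟶ y (ρ j)),
      (⟨⟨T.arr a, x, hx⟩, ⟨ρ, e, g⟩⟩ : Σ z, Labelled.Hom z (lab α y)) =
        ⟨lab (T.perm α ρ) x', labHom α ρ g'⟩ := by
  obtain ⟨rfl, rfl, ha⟩ := arrow_mk_eq e
  obtain rfl := eq_of_heq ha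
  choose x' g' h' using fun j => hom_cases (g j)
  obtain rfl : x = fun j => ⟨c (ρ j), x' j⟩ := funext fun j => congrArg Sigma.fst (h' j)
  obtain rfl : g = fun j => (Sigma.incl (C := fun i => H.obj i) _).map (g' j) := funext fun j => by simpa using h' j
  exact ⟨x', g', rfl⟩

theorem exists_labHom {n : ℕ} {c : Fin n → I} {i : I} {α : T.Hom c i} {y : ∀ j, H.obj (c j)}
    {z : Labelled T H.total} (f : z ⟶ lab α y) :
    ∃ (m : ℕ) (ρ : Fin m ≃ Fin n) (x : ∀ j, H.obj (c (ρ j))) (g : ∀ j, x j ⟶ y (ρ j)),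
      (⟨z, f⟩ : Σ z, (z ⟶ lab α y)) = ⟨lab (T.perm α ρ) x, labHom α ρ g⟩ :=
  ⟨_, f.perm, labHom_cases_aux (a := z.arrow.hom) (hx := z.deg_label) f.perm f.arrow_eq f.map⟩

theorem labHom_cases {n : ℕ} {c : Fin n → I} {i : I} {α : T.Hom c i} {y : ∀ j, H.obj (c j)}
    {P : (z : Labelled T H.total) → (z ⟶ lab α y) → Prop}
    (std : ∀ {m : ℕ} (ρ : Fin m ≃ Fin n) {x : ∀ j, H.obj (c (ρ j))} (g : ∀ j, x j ⟶ y (ρ j)),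
      P _ (labHom α ρ g))
    (z : Labelled T H.total) (f : z ⟶ lab α y) : P z f := by
  obtain ⟨m, ρ, x, g, h⟩ := exists_labHom f
  obtain ⟨rfl, h⟩ := Sigma.mk.inj h
  obtain rfl := eq_of_heq h
  exact std ρ g

theorem actMap_labHom {m n : ℕ} {c : Fin n → I} {i : I} (α : T.Hom c i) (ρ : Fin m ≃ Fin n)
    {x : ∀ j, H.obj (c (ρ j))} {y : ∀ j, H.obj (c j)} (g : ∀ j, x j ⟶ y (ρ j)) :
    H.actMap (labHom α ρ g) = (H.inc i).map ((H.prod (T.perm α ρ)).map g ≫ (H.ξ α ρ).app y) :=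
  Category.id_comp _

theorem map_prod_congr {n : ℕ} {c : Fin n → I} {i : I} {α α' : T.Hom c i} (h : α' = α)
    {x y : ∀ j, H.obj (c j)} (g : ∀ j, x j ⟶ y j) {w : H.obj i} (t : (H.prod α').obj y ⟶ w)
    (t' : (H.prod α).obj y ⟶ w) (ht : t = eqToHom (by rw [h]) ≫ t')
    (e : (⟨i, (H.prod α).obj x⟩ : H.total.carrier) = ⟨i, (H.prod α').obj x⟩) :
    eqToHom e ≫ (H.inc i).map ((H.prod α').map g ≫ t) =
      (H.inc i).map ((H.prod α).map g ≫ t') := by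
  subst h
  subst ht
  refine (Category.id_comp _).trans (congrArg (fun t => (H.inc i).map (_ ≫ t)) ?_)
  exact Category.id_comp _

theorem actMap_refl {n : ℕ} {c : Fin n → I} {i : I} (α : T.Hom c i)
    {x : ∀ j, H.obj (c j)} {y : ∀ j, H.obj (c j)} (g : ∀ j, x j ⟶ y j)
    (f : lab α x ⟶ lab α y) (h : f.perm = Equiv.refl _)
    (h' : ∀ j, HEq (f.map j) ((H.inc _).map (g j))) :
    H.actMap f = (H.inc i).map ((H.prod α).map g) := by
  obtain ⟨ρ, e, f⟩ := f
  obtain rfl := h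
  obtain rfl : f = fun j => (H.inc _).map (g j) := funext fun j => eq_of_heq (h' j)
  refine (map_prod_congr (T.perm_refl α) g ((H.ξ α (Equiv.refl _)).app y) (𝟙 _) ?_
    (H.actObj_eq (w := lab α y) e fun _ => rfl)).trans ?_
  · exact (H.ξ_refl α y).trans (Category.comp_id _).symm
  · exact congrArg (H.inc i).map (Category.comp_id _)

theorem comp_square {D : Type u} [Category.{u} D] {v w x y z t : D} {p : t ⟶ v} {q' : v ⟶ w}
    {b : w ⟶ x} {a : v ⟶ y} {q : y ⟶ x} {s : x ⟶ z} (h : q' ≫ b = a ≫ q) :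
    (p ≫ q') ≫ b ≫ s = (p ≫ a) ≫ q ≫ s := by
  simp only [Category.assoc, reassoc_of% h]

theorem actMap_comp {z w v : Labelled T H.total} (f : z ⟶ w) (g : w ⟶ v) :
    H.actMap (f ≫ g) = H.actMap f ≫ H.actMap g := by
  induction v using lab_cases with | std α v
  induction w, g using labHom_cases with | std ρ q
  induction z, f using labHom_cases with | std τ p
  refine Eq.trans ?_ ((congrArg₂ (· ≫ ·) (actMap_labHom (T.perm α ρ) τ p)
    (actMap_labHom α ρ q)).trans ((H.inc _).map_comp _ _).symm).symm
  refine (map_prod_congr (T.perm_perm α ρ τ).symm (fun j => p j ≫ q (τ j))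
    ((H.ξ α (τ.trans ρ)).app v) ((H.ξ (T.perm α ρ) τ).app (fun j => v (ρ j)) ≫ (H.ξ α ρ).app v)
    (H.ξ_trans α ρ τ v) _).trans ?_
  refine congrArg (H.inc _).map ?_
  exact (congrArg (· ≫ _) ((H.prod _).map_comp p fun j => q (τ j))).trans
    (comp_square ((H.ξ (T.perm α ρ) τ).naturality q))

theorem actMap_id (z : Labelled T H.total) : H.actMap (𝟙 z) = 𝟙 (H.actObj z) := by
  induction z using lab_cases with | std α x
  exact (actMap_refl α (fun j => 𝟙 (x j)) _ rfl fun _ => HEq.rfl).trans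
    ((congrArg (H.inc _).map ((H.prod α).map_id x)).trans ((H.inc _).map_id _))

theorem actMap_perm_aux {m n : ℕ} {c : Fin n → I} {c' : Fin m → I} {i : I} {α : T.Hom c i}
    {α' : T.Hom c' i} {x : ∀ j, H.obj (c' j)} {y : ∀ j, H.obj (c j)} {ρ : Fin m ≃ Fin n}
    (e' : T.arr α' = arrPerm (T.arr α) ρ)
    (f : ∀ j, (⟨c' j, x j⟩ : H.total.carrier) ⟶ ⟨c (ρ j), y (ρ j)⟩)
    (hx : ∀ j, HEq (x j) (y (ρ j)))
    (h : ∀ j, HEq (f j) (𝟙 (⟨c' j, x j⟩ : H.total.carrier)))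
    (e : (H.prod α').obj x = (H.prod (T.perm α ρ)).obj fun j => y (ρ j)) :
    H.actMap (z := lab α' x) (w := lab α y) ⟨ρ, e', f⟩ =
      (H.inc i).map (eqToHom e ≫ (H.ξ α ρ).app y) := by
  obtain ⟨rfl, -, ha⟩ := arrow_mk_eq e'
  obtain rfl := eq_of_heq ha
  obtain rfl : x = fun j => y (ρ j) := funext fun j => eq_of_heq (hx j)
  obtain rfl : f = fun j => (H.inc _).map (𝟙 _) := funext fun j => eq_of_heq (h j)
  refine (actMap_labHom α _ fun j => 𝟙 _).trans (congrArg (fun t => (H.inc i).map (t ≫ _)) ?_)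
  exact (H.prod _).map_id _

theorem actMap_perm {m n : ℕ} {c : Fin n → I} {c' : Fin m → I} {i : I} {α : T.Hom c i}
    {α' : T.Hom c' i} {x : ∀ j, H.obj (c' j)} {y : ∀ j, H.obj (c j)} (f : lab α' x ⟶ lab α y)
    (hx : ∀ j, HEq (x j) (y (f.perm j)))
    (h : ∀ j, HEq (f.map j) (𝟙 (⟨c' j, x j⟩ : H.total.carrier)))
    (e : (H.prod α').obj x = (H.prod (T.perm α f.perm)).obj fun j => y (f.perm j)) :
    H.actMap f = (H.inc i).map (eqToHom e ≫ (H.ξ α f.perm).app y) :=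
  actMap_perm_aux f.arrow_eq f.map hx h e

/-- A labelled operation, with labels in labelled operations. -/
abbrev lab₂ {n : ℕ} {c : Fin n → I} {i : I} (α : T.Hom c i) {m : Fin n → ℕ}
    {d : ∀ j, Fin (m j) → I} (β : ∀ j, T.Hom (d j) (c j)) (x : ∀ j k, H.obj (d j k)) :
    Labelled T (T.obj H.total) :=
  ⟨T.arr α, fun j => lab (β j) (x j), fun _ => rfl⟩

theorem lab₂_cases {P : Labelled T (T.obj H.total) → Prop}
    (std : ∀ {n : ℕ} {c : Fin n → I} {i : I} (α : T.Hom c i) {m : Fin n → ℕ}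
      {d : ∀ j, Fin (m j) → I} (β : ∀ j, T.Hom (d j) (c j)) (x : ∀ j k, H.obj (d j k)),
      P (lab₂ α β x))
    (z : Labelled T (T.obj H.total)) : P z := by
  have aux : ∀ {n : ℕ} {c : Fin n → I} {i : I} (α : T.Hom c i) (w : Fin n → Labelled T H.total)
      (hw : ∀ j, (w j).arrow.tgt = c j), P ⟨T.arr α, w, hw⟩ := by
    intro n c i α w hw
    choose m d t β x h using fun j => exists_lab (w j)
    obtain rfl : w = fun j => lab (β j) (x j) := funext h
    obtain rfl : t = c := funext hw
    exact std α β x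
  exact aux z.arrow.hom z.label z.deg_label

end Standard

/-- The action of the 2-monad `T` on the disjoint union of the categories `H i`. -/
def action : T.obj H.total ⟶ H.total :=
  CatOver.homMk
    { obj := H.actObj
      map := H.actMap
      map_id := actMap_id
      map_comp := actMap_comp }
    fun _ => rfl

/-- The unit coherence of the action, given by the units of `H`. -/
def actUnit : 𝟙 H.total ⟶ T.η H.total ≫ H.action where
  nat :=
    { app := fun z => (H.inc z.1).map ((H.ν z.1).app z.2)
      naturality := by
        rintro ⟨i, x⟩ ⟨_, y⟩ ⟨g⟩
        refine Eq.trans ?_ (congrArg (_ ≫ ·)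
          (actMap_refl (T.one i) (fun _ => g) _ rfl fun _ => HEq.rfl)).symm
        exact congrArg (H.inc i).map ((H.ν i).naturality g) }

theorem fib_prod {n : ℕ} {c : Fin n → I} {i k : I} (α : T.Hom c i) (x : ∀ j, H.obj (c j))
    (h : i = k) : fib (⟨i, (H.prod α).obj x⟩ : Σ i, H.obj i) h = (H.prod (h ▸ α)).obj x := by
  subst h
  rfl

/-- The arrow underlying a label of `z`, with target the corresponding source of the arrow
underlying `z`. -/
abbrev labelHom (z : Labelled T (T.obj H.total)) (j : Fin z.arrow.arity) :
    T.Hom (z.label j).arrow.src (z.arrow.src j) :=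
  z.deg_label j ▸ (z.label j).arrow.hom

/-- The components of the multiplication coherence of the action, given by the substitutions
of `H`. -/
def multApp (z : Labelled T (T.obj H.total)) :
    H.actObj ((T.map H.action).functor.obj z) ⟶ H.actObj (μObj z) :=
  eqToHom (congrArg (fun x => (⟨z.arrow.tgt, (H.prod z.arrow.hom).obj x⟩ : H.total.carrier))
      (funext fun j => H.fib_prod (z.label j).arrow.hom _ (z.deg_label j))) ≫
    (H.inc _).map ((H.σ z.arrow.hom (H.labelHom z)).app
      fun j k => fib ((z.label j).label k) ((z.label j).deg_label k))

section Standard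

variable {H}

theorem multApp_lab₂ {n : ℕ} {c : Fin n → I} {i : I} (α : T.Hom c i) {m : Fin n → ℕ}
    {d : ∀ j, Fin (m j) → I} (β : ∀ j, T.Hom (d j) (c j)) (x : ∀ j k, H.obj (d j k)) :
    H.multApp (lab₂ α β x) = (H.inc i).map ((H.σ α β).app x) :=
  Category.id_comp ((H.inc i).map ((H.σ α β).app x))

/-- A levelwise morphism. -/
abbrev level₂ {n : ℕ} {c : Fin n → I} {i : I} (α : T.Hom c i) {m : Fin n → ℕ}
    {d : ∀ j, Fin (m j) → I} (β : ∀ j, T.Hom (d j) (c j)) {x y : ∀ j k, H.obj (d j k)}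
    (g : ∀ j k, x j k ⟶ y j k) : lab₂ α β x ⟶ lab₂ α β y :=
  ⟨Equiv.refl _, (arrPerm_refl _).symm, fun j =>
    ⟨Equiv.refl _, (arrPerm_refl _).symm, fun k => (H.inc _).map (g j k)⟩⟩

/-- A permutative morphism. -/
abbrev perm₂ {n n' : ℕ} {c : Fin n → I} {i : I} (α : T.Hom c i) {m : Fin n → ℕ}
    {d : ∀ j, Fin (m j) → I} (β : ∀ j, T.Hom (d j) (c j)) {m' : Fin n' → ℕ}
    (ρ : Fin n' ≃ Fin n) (τ : ∀ j, Fin (m' j) ≃ Fin (m (ρ j))) (y : ∀ j k, H.obj (d j k)) :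
    lab₂ (T.perm α ρ) (fun j => T.perm (β (ρ j)) (τ j)) (fun j k => y (ρ j) (τ j k)) ⟶
      lab₂ α β y :=
  ⟨ρ, rfl, fun j => labHom (β (ρ j)) (τ j) fun k => 𝟙 (y (ρ j) (τ j k))⟩

theorem hom₂_cases {n : ℕ} {c : Fin n → I} {i : I} {α : T.Hom c i} {m : Fin n → ℕ}
    {d : ∀ j, Fin (m j) → I} {β : ∀ j, T.Hom (d j) (c j)} {y : ∀ j k, H.obj (d j k)}
    {P : (z : Labelled T (T.obj H.total)) → (z ⟶ lab₂ α β y) → Prop}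
    (std : ∀ {n' : ℕ} {m' : Fin n' → ℕ} (ρ : Fin n' ≃ Fin n)
      (τ : ∀ j, Fin (m' j) ≃ Fin (m (ρ j))) {x : ∀ j k, H.obj (d (ρ j) (τ j k))}
      (g : ∀ j k, x j k ⟶ y (ρ j) (τ j k)),
      P _ (level₂ (T.perm α ρ) (fun j => T.perm (β (ρ j)) (τ j)) g ≫ perm₂ α β ρ τ y))
    (z : Labelled T (T.obj H.total)) (f : z ⟶ lab₂ α β y) : P z f := by
  have aux : ∀ {n' : ℕ} {c' : Fin n' → I} {i' : I} (a : T.Hom c' i')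
      (w : Fin n' → Labelled T H.total) (hw : ∀ j, (w j).arrow.tgt = c' j) (ρ : Fin n' ≃ Fin n)
      (e : T.arr a = arrPerm (T.arr α) ρ) (q : ∀ j, w j ⟶ lab (β (ρ j)) (y (ρ j))),
      P ⟨T.arr a, w, hw⟩ ⟨ρ, e, q⟩ := by
    intro n' c' i' a w hw ρ e q
    obtain ⟨rfl, rfl, ha⟩ := arrow_mk_eq e
    obtain rfl := eq_of_heq ha
    choose m' τ x g h using fun j => exists_labHom (y := y (ρ j)) (q j)
    obtain rfl : w = fun j => lab (T.perm (β (ρ j)) (τ j)) (x j) :=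
      funext fun j => congrArg Sigma.fst (h j)
    obtain rfl : q = fun j => labHom (β (ρ j)) (τ j) (g j) := funext fun j => by
      simpa using h j
    have := std ρ τ g
    refine cast (congrArg (P _) ?_) this
    refine Labelled.Hom.ext (fun _ => rfl) fun j => heq_of_eq ?_
    refine Labelled.Hom.ext (fun _ => rfl) fun k => heq_of_eq ?_
    exact Category.comp_id _
  exact aux z.arrow.hom z.label z.deg_label f.perm f.arrow_eq f.map

theorem multApp_level {n : ℕ} {c : Fin n → I} {i : I} (α : T.Hom c i) {m : Fin n → ℕ}
    {d : ∀ j, Fin (m j) → I} (β : ∀ j, T.Hom (d j) (c j)) {x y : ∀ j k, H.obj (d j k)}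
    (g : ∀ j k, x j k ⟶ y j k) :
    (T.map H.action ≫ H.action).functor.map (level₂ α β g) ≫ H.multApp (lab₂ α β y) =
      H.multApp (lab₂ α β x) ≫ (T.μ _ ≫ H.action).functor.map (level₂ α β g) := by
  have h1 : (T.map H.action ≫ H.action).functor.map (level₂ α β g) =
      (H.inc i).map ((H.prod α).map fun j => (H.prod (β j)).map (g j)) :=
    actMap_refl (x := fun j => (H.prod (β j)).obj (x j)) (y := fun j => (H.prod (β j)).obj (y j))
      α (fun j => (H.prod (β j)).map (g j)) _ rfl
      fun j => heq_of_eq (actMap_refl (β j) (g j) _ rfl fun _ => HEq.rfl)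
  have h2 : (T.μ _ ≫ H.action).functor.map (level₂ α β g) =
      (H.inc i).map ((H.prod (T.comp α β)).map (concat g)) :=
    actMap_refl (x := concat x) (y := concat y) (T.comp α β) (concat g)
      (μMap (level₂ α β g)) (Equiv.ext fun l => pos_injective _ (μMap_position (level₂ α β g) l))
      fun l => μMap_map_heq (level₂ α β g) l
  refine (congrArg₂ (· ≫ ·) h1 (multApp_lab₂ α β y)).trans
    (Eq.trans ?_ (congrArg₂ (· ≫ ·) (multApp_lab₂ α β x) h2).symm)
  exact congrArg (H.inc i).map ((H.σ α β).naturality g)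

theorem multApp_perm {n n' : ℕ} {c : Fin n → I} {i : I} (α : T.Hom c i) {m : Fin n → ℕ}
    {d : ∀ j, Fin (m j) → I} (β : ∀ j, T.Hom (d j) (c j)) {m' : Fin n' → ℕ}
    (ρ : Fin n' ≃ Fin n) (τ : ∀ j, Fin (m' j) ≃ Fin (m (ρ j))) (y : ∀ j k, H.obj (d j k)) :
    (T.map H.action ≫ H.action).functor.map (perm₂ α β ρ τ y) ≫ H.multApp (lab₂ α β y) =
      H.multApp (lab₂ _ _ _) ≫ (T.μ _ ≫ H.action).functor.map (perm₂ α β ρ τ y) := by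
  have h0 (j) : H.actMap (labHom (β (ρ j)) (τ j) fun k => 𝟙 (y (ρ j) (τ j k))) =
      (H.inc _).map ((H.ξ (β (ρ j)) (τ j)).app (y (ρ j))) :=
    (actMap_labHom _ _ _).trans (congrArg (H.inc _).map
      ((congrArg (· ≫ _) ((H.prod _).map_id _)).trans (Category.id_comp _)))
  have h1 : (T.map H.action ≫ H.action).functor.map (perm₂ α β ρ τ y) =
      (H.inc i).map ((H.prod (T.perm α ρ)).map (fun j => (H.ξ (β (ρ j)) (τ j)).app (y (ρ j))) ≫
      (H.ξ α ρ).app (fun j => (H.prod (β j)).obj (y j))) := by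
    refine Eq.trans ?_ (actMap_labHom α ρ (y := fun j => (H.prod (β j)).obj (y j))
      fun j => (H.ξ (β (ρ j)) (τ j)).app (y (ρ j)))
    exact congrArg H.actMap (Labelled.Hom.ext (fun _ => rfl) fun j => heq_of_eq (h0 j))
  have h2 : (T.μ _ ≫ H.action).functor.map (perm₂ α β ρ τ y) =
      (H.inc i).map (eqToHom (prod_congr H.prod (T.comp_perm α β ρ τ)
          fun _ _ => congr_blockEquiv y ρ τ) ≫
        (H.ξ (T.comp α β) (blockEquiv ρ τ)).app (concat y)) :=
    actMap_perm (y := concat y) (μMap (perm₂ α β ρ τ y)) (fun l => congr_blockEquiv y ρ τ rfl)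
      (fun l => μMap_map_heq _ l) _
  refine (congrArg₂ (· ≫ ·) h1 (multApp_lab₂ α β y)).trans
    (Eq.trans ?_ (congrArg₂ (· ≫ ·) (multApp_lab₂ _ _ _) h2).symm)
  exact congrArg (H.inc i).map ((Category.assoc _ _ _).trans (H.σ_ξ α β ρ τ y).symm)

theorem naturality_comp {D E : Type u} [Category.{u} D] [Category.{u} E] (F G : D ⥤ E)
    {x y z : D} {f : x ⟶ y} {g : y ⟶ z} (a : F.obj x ⟶ G.obj x) (b : F.obj y ⟶ G.obj y)
    (c : F.obj z ⟶ G.obj z) (h : F.map f ≫ b = a ≫ G.map f) (h' : F.map g ≫ c = b ≫ G.map g) :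
    F.map (f ≫ g) ≫ c = a ≫ G.map (f ≫ g) := by
  rw [F.map_comp, G.map_comp, Category.assoc, h', reassoc_of% h]

theorem multApp_naturality {z w : Labelled T (T.obj H.total)} (f : z ⟶ w) :
    (T.map H.action ≫ H.action).functor.map f ≫ H.multApp w =
      H.multApp z ≫ (T.μ _ ≫ H.action).functor.map f := by
  induction w using lab₂_cases with | std α β y
  induction z, f using hom₂_cases with | std ρ τ g
  exact naturality_comp (T.map H.action ≫ H.action).functor (T.μ _ ≫ H.action).functor
    (H.multApp _) (H.multApp _) (H.multApp _) (multApp_level _ _ g) (multApp_perm α β ρ τ y)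

end Standard

/-- The multiplication coherence of the action, given by the substitutions of `H`. -/
def actMult : T.map H.action ≫ H.action ⟶ T.μ H.total ≫ H.action where
  nat :=
    { app := H.multApp
      naturality := fun _ _ f => multApp_naturality f }

end LaxOperadMorphism

namespace LaxOperadMorphism

open Sigma Operad

variable {I : Type u} {T : Operad I} (H K : LaxOperadMorphism T)

theorem lab₃_cases {P : Labelled T (T.obj (T.obj H.total)) → Prop}
    (std : ∀ {n : ℕ} {c : Fin n → I} {i : I} (α : T.Hom c i) {m : Fin n → ℕ}
      {d : ∀ j, Fin (m j) → I} (β : ∀ j, T.Hom (d j) (c j)) {p : ∀ j, Fin (m j) → ℕ}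
      {b : ∀ j k, Fin (p j k) → I} (γ : ∀ j k, T.Hom (b j k) (d j k))
      (x : ∀ j k r, H.obj (b j k r)),
      P ⟨T.arr α, fun j => lab₂ (β j) (γ j) (x j), fun _ => rfl⟩)
    (z : Labelled T (T.obj (T.obj H.total))) : P z := by
  have key (w : Labelled T (T.obj H.total)) : ∃ (n : ℕ) (c : Fin n → I) (i : I) (α : T.Hom c i)
      (m : Fin n → ℕ) (d : ∀ j, Fin (m j) → I) (β : ∀ j, T.Hom (d j) (c j))
      (x : ∀ j k, H.obj (d j k)), w = lab₂ α β x := by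
    induction w using lab₂_cases with | std α β x
    exact ⟨_, _, _, α, _, _, β, x, rfl⟩
  have aux : ∀ {n : ℕ} {c : Fin n → I} {i : I} (α : T.Hom c i)
      (w : Fin n → Labelled T (T.obj H.total))
      (hw : ∀ j, (w j).arrow.tgt = c j), P ⟨T.arr α, w, hw⟩ := by
    intro n c i α w hw
    choose m d t β p b γ x h using fun j => key (w j)
    obtain rfl : w = fun j => lab₂ (β j) (γ j) (x j) := funext h
    obtain rfl : t = c := funext hw
    exact std α β γ x
  exact aux z.arrow.hom z.label z.deg_label

theorem inc_comp_eqToHom {i : I} {x y z : H.obj i} (f : x ⟶ y)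
    (e : (⟨i, y⟩ : H.total.carrier) = ⟨i, y⟩) (g : y ⟶ z) :
    (H.inc i).map f ≫ eqToHom e ≫ (H.inc i).map g = (H.inc i).map (f ≫ g) :=
  (congrArg (_ ≫ ·) (Category.id_comp _)).trans ((H.inc i).map_comp f g).symm

theorem inc_eqToHom {i : I} {x y : H.obj i} (h : x = y)
    (e : (⟨i, x⟩ : H.total.carrier) = ⟨i, y⟩) : (H.inc i).map (eqToHom h) = eqToHom e :=
  eqToHom_map _ _

theorem inc_assoc {i : I} {x₀ x₁ x₂ x₃ y₁ : H.obj i} {f : x₀ ⟶ x₁} {g : x₁ ⟶ x₂}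
    {f' : x₀ ⟶ y₁} {g' : y₁ ⟶ x₃} {h : x₂ = x₃} (hh : f ≫ g ≫ eqToHom h = f' ≫ g')
    (e : (⟨i, x₁⟩ : H.total.carrier) = ⟨i, x₁⟩) (e₀ : (⟨i, x₀⟩ : H.total.carrier) = ⟨i, x₀⟩)
    (e₁ : (⟨i, y₁⟩ : H.total.carrier) = ⟨i, y₁⟩) (e₂ : (⟨i, x₃⟩ : H.total.carrier) = ⟨i, x₂⟩) :
    (H.inc i).map f ≫ eqToHom e ≫ (H.inc i).map g =
      eqToHom e₀ ≫ (H.inc i).map f' ≫ eqToHom e₁ ≫ (H.inc i).map g' ≫ eqToHom e₂ := by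
  subst h
  refine (inc_comp_eqToHom _ _ _ _).trans (Eq.trans ?_ (Category.id_comp _).symm)
  refine Eq.trans ?_ (congrArg (fun t => (H.inc i).map f' ≫ eqToHom e₁ ≫ t)
    (Category.comp_id _)).symm
  refine Eq.trans ?_ (inc_comp_eqToHom _ _ _ _).symm
  rw [← hh, eqToHom_refl, Category.comp_id]

/-- The lax algebra corresponding to a lax morphism of operads `T → Cat`. -/
def toLaxAlgebra : T.twoMonad.LaxAlgebra H.total where
  act := H.action
  unit := H.actUnit
  mult := H.actMult
  unit_left := CatOver.hom₂_ext fun z => by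
    rw [CatOver.app_comp, CatOver.app_comp, CatOver.app_eqToHom, CatOver.app_eqToHom]
    revert z
    refine lab_cases fun {n c i} α x => ?_
    refine Eq.trans ?_ ((congrArg (H.inc i).map (H.one_σ α x)).trans (H.inc_eqToHom _ _))
    refine Eq.trans ?_ (H.inc_comp_eqToHom _ rfl _)
    exact congrArg (fun t => _ ≫ _ ≫ t) (multApp_lab₂ (T.one i) (fun _ => α) fun _ => x)
  unit_right := CatOver.hom₂_ext fun z => by
    rw [CatOver.app_comp, CatOver.app_comp, CatOver.app_eqToHom, CatOver.app_eqToHom]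
    revert z
    refine lab_cases fun {n c i} α x => ?_
    refine Eq.trans ?_ ((congrArg (H.inc i).map (H.σ_one α x)).trans (H.inc_eqToHom _ _))
    refine Eq.trans ?_ (H.inc_comp_eqToHom _ rfl _)
    exact congrArg₂ (fun s t => s ≫ 𝟙 _ ≫ t)
      (actMap_refl α (y := fun j => (H.prod (T.one (c j))).obj fun _ => x j)
        (fun j => (H.ν (c j)).app (x j)) _ rfl fun _ => HEq.rfl)
      (multApp_lab₂ α (fun j => T.one (c j)) fun j _ => x j)
  assoc := CatOver.hom₂_ext fun z => by
    simp only [CatOver.app_comp, CatOver.app_eqToHom]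
    revert z
    refine H.lab₃_cases fun {n c i} α {m d} β {p b} γ x => ?_
    have h1 : H.actMap (CatOver.app (T.map₂ H.actMult)
        ⟨T.arr α, fun j => lab₂ (β j) (γ j) (x j), fun _ => rfl⟩) =
        (H.inc i).map ((H.prod α).map fun j => (H.σ (β j) (γ j)).app (x j)) :=
      actMap_refl α (x := fun j => (H.prod (β j)).obj fun k => (H.prod (γ j k)).obj (x j k))
        (y := fun j => (H.prod (T.comp (β j) (γ j))).obj (concat (x j)))
        (fun j => (H.σ (β j) (γ j)).app (x j)) _ rfl
        fun j => heq_of_eq (multApp_lab₂ (β j) (γ j) (x j))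
    refine Eq.trans (congrArg₂ (fun s t => s ≫ 𝟙 _ ≫ t)
      (multApp_lab₂ α β fun j k => (H.prod (γ j k)).obj (x j k))
      (multApp_lab₂ (T.comp α β) (concat γ) (concat x))) ?_
    refine Eq.trans (H.inc_assoc (H.σ_σ α β γ x) rfl rfl rfl
      (Sigma.ext rfl (heq_of_eq (prod_congr H.prod (T.comp_comp α β γ)
        fun _ _ => congr_assoc x).symm))) ?_
    exact congrArg₂ (fun s t => 𝟙 _ ≫ s ≫ 𝟙 _ ≫ t ≫ _) h1.symm
      (multApp_lab₂ α (fun j => T.comp (β j) (γ j)) fun j => concat (x j)).symm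

end LaxOperadMorphism

namespace LaxOperadMorphism

open Sigma Operad

variable {I : Type u} {T : Operad I} {H K : LaxOperadMorphism T}

/-- The arrow of `Cat/I` with fibres `F i`. -/
def totalHom (F : ∀ i, H.obj i ⥤ K.obj i) : H.total ⟶ K.total :=
  CatOver.homMk (Sigma.Functor.sigma (C := fun i => H.obj i) (D := fun i => K.obj i) F) fun _ => rfl

/-- The 2-cell of `Cat/I` with fibres `ψ i`. -/
def totalCell {F G : ∀ i, H.obj i ⥤ K.obj i} (ψ : ∀ i, F i ⟶ G i) : totalHom F ⟶ totalHom G where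
  nat := Sigma.natTrans.sigma (C := fun i => H.obj i) (D := fun i => K.obj i) ψ

theorem totalHom_inc (F : ∀ i, H.obj i ⥤ K.obj i) {i : I} {x y : H.obj i} (g : x ⟶ y) :
    (totalHom F).functor.map ((H.inc i).map g) = (K.inc i).map ((F i).map g) := rfl

theorem totalHom_eqToHom (F : ∀ i, H.obj i ⥤ K.obj i) (z : Σ i, H.obj i) {i : I} (h : z.1 = i) :
    fib ((totalHom F).functor.obj z) h = (F i).obj (fib z h) := by
  subst h
  rfl

theorem actObj_totalHom (F : ∀ i, H.obj i ⥤ K.obj i) (z : Labelled T H.total) :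
    K.actObj ((T.map (totalHom F)).functor.obj z) =
      ⟨z.arrow.tgt, (K.prod z.arrow.hom).obj fun j =>
        (F _).obj (fib (z.label j) (z.deg_label j))⟩ :=
  congrArg (fun x => (⟨z.arrow.tgt, (K.prod z.arrow.hom).obj x⟩ : K.total.carrier))
    (funext fun j => totalHom_eqToHom F (z.label j) (z.deg_label j))

theorem inc_cell {F G : ∀ i, H.obj i ⥤ K.obj i} (ψ : ∀ i, F i ⟶ G i) {i : I} (x : H.obj i) :
    CatOver.app (totalCell ψ) ⟨i, x⟩ = (K.inc i).map ((ψ i).app x) := rfl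

theorem map_unit {D E : Type u} [Category.{u} D] [Category.{u} E] (P : D ⥤ E) {x y z : D}
    {p : x ⟶ y} {q : y ⟶ z} {r : x ⟶ z} (h : p ≫ q = r) (e₁ : P.obj x = P.obj x)
    (e₂ : P.obj y = P.obj y) (e₃ : P.obj x = P.obj x) (e₄ : P.obj z = P.obj z) :
    eqToHom e₁ ≫ P.map p ≫ eqToHom e₂ ≫ P.map q = eqToHom e₃ ≫ P.map r ≫ eqToHom e₄ := by
  simp [← h]

theorem map_mult {D E : Type u} [Category.{u} D] [Category.{u} E] (P : D ⥤ E)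
    {x y z v w : D} {p : x ⟶ y} {q : y ⟶ z} {r : x ⟶ v} {s : v ⟶ w} {t : w ⟶ z}
    (h : p ≫ q = r ≫ s ≫ t) (e₀ : P.obj y = P.obj y) (e₁ : P.obj x = P.obj x)
    (e₂ : P.obj v = P.obj v) (e₃ : P.obj w = P.obj w) (e₄ : P.obj z = P.obj z) :
    P.map p ≫ eqToHom e₀ ≫ P.map q = eqToHom e₁ ≫ P.map r ≫ eqToHom e₂ ≫ P.map s ≫
      eqToHom e₃ ≫ P.map t ≫ eqToHom e₄ := by
  simp [← Functor.map_comp, h]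

namespace LaxNatTrans

variable (f g : LaxNatTrans H K)

/-- The components of the coherence datum of the algebra morphism corresponding to `f`. -/
def cellApp (z : Labelled T H.total) :
    K.actObj ((T.map (totalHom f.functor)).functor.obj z) ⟶
      (totalHom f.functor).functor.obj (H.actObj z) :=
  eqToHom (actObj_totalHom f.functor z) ≫
    (K.inc _).map ((f.cell z.arrow.hom).app fun j => fib (z.label j) (z.deg_label j))

variable {f} in
theorem cellApp_lab {n : ℕ} {c : Fin n → I} {i : I} (α : T.Hom c i) (x : ∀ j, H.obj (c j)) :
    f.cellApp (lab α x) = (K.inc i).map ((f.cell α).app x) :=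
  Category.id_comp ((K.inc i).map ((f.cell α).app x))

variable {f} in
theorem cellApp_naturality {z w : Labelled T H.total} (q : z ⟶ w) :
    (T.map (totalHom f.functor) ≫ K.action).functor.map q ≫ f.cellApp w =
      f.cellApp z ≫ (H.action ≫ totalHom f.functor).functor.map q := by
  induction w using lab_cases with | std α y
  induction z, q using labHom_cases with | @std m ρ x g
  have h1 : (T.map (totalHom f.functor) ≫ K.action).functor.map (labHom α ρ g) =
      (K.inc _).map ((K.prod (T.perm α ρ)).map (fun j => (f.functor _).map (g j)) ≫
        (K.ξ α ρ).app fun j => (f.functor _).obj (y j)) :=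
    actMap_labHom (x := fun j => (f.functor _).obj (x j)) (y := fun j => (f.functor _).obj (y j))
      α ρ fun j => (f.functor _).map (g j)
  have h2 : (H.action ≫ totalHom f.functor).functor.map (labHom α ρ g) =
      (K.inc _).map ((f.functor _).map ((H.prod (T.perm α ρ)).map g ≫ (H.ξ α ρ).app y)) :=
    congrArg (totalHom f.functor).functor.map (actMap_labHom α ρ g)
  refine (congrArg₂ (· ≫ ·) h1 (cellApp_lab α y)).trans
    (Eq.trans ?_ (congrArg₂ (· ≫ ·) (cellApp_lab _ _) h2).symm)
  refine congrArg (K.inc _).map ?_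
  refine (Category.assoc _ _ _).trans ((congrArg (_ ≫ ·) (f.cell_ξ α ρ y).symm).trans ?_)
  refine Eq.trans ?_ (congrArg (_ ≫ ·) ((f.functor _).map_comp _ _)).symm
  exact (Category.assoc _ _ _).symm.trans ((congrArg (· ≫ _)
    ((f.cell (T.perm α ρ)).naturality g)).trans (Category.assoc _ _ _))

/-- The coherence datum of the algebra morphism corresponding to `f`. -/
def algCell : T.map (totalHom f.functor) ≫ K.action ⟶ H.action ≫ totalHom f.functor where
  nat :=
    { app := f.cellApp
      naturality := fun _ _ q => cellApp_naturality q }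

/-- The lax algebra morphism corresponding to a lax-natural transformation. -/
def toLaxMorphism :
    TwoMonad.LaxMorphism H.toLaxAlgebra K.toLaxAlgebra (totalHom f.functor) where
  cell := f.algCell
  unit := CatOver.hom₂_ext fun z => by
    simp only [CatOver.app_comp, CatOver.app_eqToHom]
    obtain ⟨i, x⟩ := z
    refine Eq.trans (congrArg (fun t => 𝟙 _ ≫ _ ≫ 𝟙 _ ≫ t)
      (cellApp_lab (T.one i) fun _ => x)) ?_
    exact map_unit (K.inc i) (f.cell_ν i x) rfl rfl rfl rfl
  mult := CatOver.hom₂_ext fun z => by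
    simp only [CatOver.app_comp, CatOver.app_eqToHom]
    revert z
    refine lab₂_cases fun {n c i} α {m d} β x => ?_
    have h1 : K.actMap (CatOver.app (F := T.map (T.map (totalHom f.functor) ≫ K.action))
          (G := T.map (H.action ≫ totalHom f.functor))
          (T.map₂ f.algCell) (lab₂ α β x)) =
        (K.inc i).map ((K.prod α).map fun j => (f.cell (β j)).app (x j)) :=
      actMap_refl α (x := fun j => (K.prod (β j)).obj fun k => (f.functor _).obj (x j k))
        (y := fun j => (f.functor _).obj ((H.prod (β j)).obj (x j)))
        (fun j => (f.cell (β j)).app (x j)) _ rfl fun j => heq_of_eq (cellApp_lab (β j) (x j))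
    refine Eq.trans (congrArg₂ (fun s t => s ≫ 𝟙 _ ≫ t)
      (multApp_lab₂ α β fun j k => (f.functor _).obj (x j k))
      (cellApp_lab (T.comp α β) (concat x))) ?_
    refine Eq.trans (map_mult (K.inc i) (f.cell_σ α β x) rfl rfl rfl rfl rfl) ?_
    refine congrArg₂ (fun s t => 𝟙 _ ≫ s ≫ t) h1.symm ?_
    exact congrArg₂ (fun s t => 𝟙 _ ≫ s ≫ 𝟙 _ ≫ t ≫ 𝟙 _)
      (cellApp_lab α fun j => (H.prod (β j)).obj (x j)).symm
      (congrArg (totalHom f.functor).functor.map (multApp_lab₂ α β x).symm)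

end LaxNatTrans

end LaxOperadMorphism

namespace LaxOperadMorphism

open Sigma Operad

variable {I : Type u} {T : Operad I} {H K : LaxOperadMorphism T}

namespace ColaxNatTrans

variable (f g : ColaxNatTrans H K)

/-- The components of the coherence datum of the algebra morphism corresponding to `f`. -/
def cellApp (z : Labelled T H.total) :
    (totalHom f.functor).functor.obj (H.actObj z) ⟶
      K.actObj ((T.map (totalHom f.functor)).functor.obj z) :=
  (K.inc _).map ((f.cell z.arrow.hom).app fun j => fib (z.label j) (z.deg_label j)) ≫
    eqToHom (actObj_totalHom f.functor z).symm

variable {f} in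
theorem cellApp_lab {n : ℕ} {c : Fin n → I} {i : I} (α : T.Hom c i) (x : ∀ j, H.obj (c j)) :
    f.cellApp (lab α x) = (K.inc i).map ((f.cell α).app x) :=
  Category.comp_id ((K.inc i).map ((f.cell α).app x))

variable {f} in
theorem cellApp_naturality {z w : Labelled T H.total} (q : z ⟶ w) :
    (H.action ≫ totalHom f.functor).functor.map q ≫ f.cellApp w =
      f.cellApp z ≫ (T.map (totalHom f.functor) ≫ K.action).functor.map q := by
  induction w using lab_cases with | std α y
  induction z, q using labHom_cases with | @std m ρ x g
  have h1 : (T.map (totalHom f.functor) ≫ K.action).functor.map (labHom α ρ g) =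
      (K.inc _).map ((K.prod (T.perm α ρ)).map (fun j => (f.functor _).map (g j)) ≫
        (K.ξ α ρ).app fun j => (f.functor _).obj (y j)) :=
    actMap_labHom (x := fun j => (f.functor _).obj (x j)) (y := fun j => (f.functor _).obj (y j))
      α ρ fun j => (f.functor _).map (g j)
  have h2 : (H.action ≫ totalHom f.functor).functor.map (labHom α ρ g) =
      (K.inc _).map ((f.functor _).map ((H.prod (T.perm α ρ)).map g) ≫
        (f.functor _).map ((H.ξ α ρ).app y)) :=
    (congrArg (totalHom f.functor).functor.map (actMap_labHom α ρ g)).trans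
      (congrArg (K.inc _).map ((f.functor _).map_comp _ _))
  refine (congrArg₂ (· ≫ ·) h2 (cellApp_lab α y)).trans
    (Eq.trans ?_ (congrArg₂ (· ≫ ·) (cellApp_lab _ _) h1).symm)
  refine congrArg (K.inc _).map ?_
  refine (Category.assoc _ _ _).trans ((congrArg (_ ≫ ·) (f.cell_ξ α ρ y).symm).trans ?_)
  exact (Category.assoc _ _ _).symm.trans ((congrArg (· ≫ _)
    ((f.cell (T.perm α ρ)).naturality g)).trans (Category.assoc _ _ _))

/-- The coherence datum of the algebra morphism corresponding to `f`. -/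
def algCell : H.action ≫ totalHom f.functor ⟶ T.map (totalHom f.functor) ≫ K.action where
  nat :=
    { app := f.cellApp
      naturality := fun _ _ q => cellApp_naturality q }

/-- The colax algebra morphism corresponding to a colax-natural transformation. -/
def toColaxMorphism :
    TwoMonad.ColaxMorphism H.toLaxAlgebra K.toLaxAlgebra (totalHom f.functor) where
  cell := f.algCell
  unit := CatOver.hom₂_ext fun z => by
    simp only [CatOver.app_comp, CatOver.app_eqToHom]
    obtain ⟨i, x⟩ := z
    refine Eq.trans (congrArg (fun t => 𝟙 _ ≫ _ ≫ 𝟙 _ ≫ t)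
      (cellApp_lab (T.one i) fun _ => x)) ?_
    exact map_unit (K.inc i) (f.cell_ν i x) rfl rfl rfl rfl
  mult := CatOver.hom₂_ext fun z => by
    simp only [CatOver.app_comp, CatOver.app_eqToHom]
    revert z
    refine lab₂_cases fun {n c i} α {m d} β x => ?_
    have h1 : K.actMap (CatOver.app (F := T.map (H.action ≫ totalHom f.functor))
          (G := T.map (T.map (totalHom f.functor) ≫ K.action))
          (T.map₂ f.algCell) (lab₂ α β x)) =
        (K.inc i).map ((K.prod α).map fun j => (f.cell (β j)).app (x j)) :=
      actMap_refl α (y := fun j => (K.prod (β j)).obj fun k => (f.functor _).obj (x j k))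
        (x := fun j => (f.functor _).obj ((H.prod (β j)).obj (x j)))
        (fun j => (f.cell (β j)).app (x j)) _ rfl fun j => heq_of_eq (cellApp_lab (β j) (x j))
    refine Eq.trans (congrArg₂ (fun s t => s ≫ 𝟙 _ ≫ t)
      (congrArg (totalHom f.functor).functor.map (multApp_lab₂ α β x))
      (cellApp_lab (T.comp α β) (concat x))) ?_
    refine Eq.trans (map_mult (K.inc i) (f.cell_σ α β x) rfl rfl rfl rfl rfl) ?_
    refine congrArg₂ (fun s t => 𝟙 _ ≫ s ≫ 𝟙 _ ≫ t)
      (cellApp_lab α fun j => (H.prod (β j)).obj (x j)).symm ?_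
    exact congrArg₂ (fun s t => s ≫ 𝟙 _ ≫ t ≫ 𝟙 _) h1.symm
      (multApp_lab₂ α β fun j k => (f.functor _).obj (x j k)).symm

end ColaxNatTrans

end LaxOperadMorphism

/-! ### Equality of algebra 2-cells. -/

namespace TwoMonad

variable {𝒦 : Type u} [Bicategory.{w, v} 𝒦] [Bicategory.Strict 𝒦] {M : TwoMonad 𝒦} {A B : 𝒦}
  {a : M.LaxAlgebra A} {b : M.LaxAlgebra B} {f g : A ⟶ B}

/-! Both notions consist of the same data subject to the same equations, and the proof separates the
two claims.

Data. The total category of `H` is the disjoint union of the fibres `H.obj i`: no arrow joins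
different fibres, and each inclusion `inc i` is fully faithful. A 2-cell θ from ∫f to ∫g has at `⟨i,
x⟩` a component between two objects of the fibre of `K` over `i`, hence a unique arrow from `f_i x`
to `g_i x` there. Naturality of θ only concerns arrows inside a fibre, so it says that each of these
families is natural, with no condition linking different `i`. Thus 2-cells over `I` are exactly
families `ψ i`; this is `totalCellEquiv`.

Equations. The algebra condition equates two 2-cells whose source is a functor on T∫H, so it may be
tested on objects. By `lab_cases` every object of T∫H is some `lab α x`, that is, an operation `α`
together with a tuple `x` of objects in the fibres named by its source. At such an object the cells
of the algebra morphisms are the components of `f.cell α` and `g.cell α` (`cellApp_lab`), whiskering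
with the action of `H` evaluates ψ at `H_α x`, and the action of `K` sends the component of Tψ to
`K_α` applied to the tuple of components of ψ (`actMap_map₂_totalCell`). The algebra condition at
`lab α x` is therefore the image under `inc i` of the modification condition at `(α, x)`, and
faithfulness of `inc i` makes the two equivalent; this is `comm_iff`.

The structure maps ξ, ν and σ have done their work in the construction of the algebras and their
morphisms. Here only ξ at an identity permutation occurs, and it is trivial. The colax case is the
same computation with the coherence cells reversed. -/

/-- Compatibility with the actions is a property of the underlying 2-cell and not further structure,
so proof irrelevance settles it. Hence the bijection on underlying 2-cells restricts to algebra
2-cells without any further check. -/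
theorem LaxMorphism.TwoCell.ext {F : LaxMorphism a b f} {G : LaxMorphism a b g}
    {θ θ' : TwoCell F G} (h : θ.cell = θ'.cell) : θ = θ' := by
  cases θ; cases θ'; cases h; rfl

theorem ColaxMorphism.TwoCell.ext {F : ColaxMorphism a b f} {G : ColaxMorphism a b g}
    {θ θ' : TwoCell F G} (h : θ.cell = θ'.cell) : θ = θ' := by
  cases θ; cases θ'; cases h; rfl

end TwoMonad

/-! ### 2-cells over `I` as families of natural transformations on the fibres. -/

namespace LaxOperadMorphism

open Sigma Operad

variable {I : Type u} {T : Operad I} {H K : LaxOperadMorphism T}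

/-- The 2-cells of `Cat/I` between arrows given by fibres are the families of natural
transformations between the fibres. -/
noncomputable def totalCellEquiv (F G : ∀ i, H.obj i ⥤ K.obj i) :
    (∀ i, F i ⟶ G i) ≃ (totalHom F ⟶ totalHom G) where
  toFun := totalCell
  -- The source and target of the component at `⟨i, x⟩` are, by definition, the images under `K.inc
  -- i` of `F i` and `G i` at `x`, so fullness of the inclusion supplies the arrow. Fullness only
  -- asserts existence, hence the choice of a preimage and `noncomputable`; faithfulness makes the
  -- choice immaterial.
  invFun θ i :=
    { app := fun x => (K.inc i).preimage (CatOver.app θ ⟨i, x⟩)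
      -- The square is tested after the faithful functor `K.inc i`. There it becomes the naturality
      -- square of θ at the image of `q` in the total category, because `totalHom F` sends that
      -- image to the inclusion of `(F i).map q` by definition.
      naturality := fun x y q => (K.inc i).map_injective <|
        ((K.inc i).map_comp _ _).trans <|
          (congrArg (_ ≫ ·) ((K.inc i).map_preimage (CatOver.app θ ⟨i, y⟩))).trans <|
          (θ.nat.naturality ((H.inc i).map q)).trans <|
          (congrArg (· ≫ _) ((K.inc i).map_preimage (CatOver.app θ ⟨i, x⟩))).symm.trans
            ((K.inc i).map_comp _ _).symm }
  -- The component of `totalCell ψ` at `⟨i, x⟩` is already an arrow in the image of `K.inc i`;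
  -- faithfulness forces its chosen preimage to be the original component.
  left_inv _ := funext fun i => NatTrans.ext (funext fun _ =>
    (K.inc i).map_injective ((K.inc i).map_preimage _))
  -- Every object of the disjoint union is a pair `⟨i, x⟩`, so the fibres account for all components
  -- of θ.
  right_inv θ := CatOver.hom₂_ext fun ⟨i, x⟩ =>
    (K.inc i).map_preimage (CatOver.app θ ⟨i, x⟩)

/-- The effect of the action on the image under `T` of a 2-cell given by fibres. -/
theorem actMap_map₂_totalCell {F G : ∀ i, H.obj i ⥤ K.obj i} (ψ : ∀ i, F i ⟶ G i) {n : ℕ}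
    {c : Fin n → I} {i : I} (α : T.Hom c i) (x : ∀ j, H.obj (c j)) :
    K.actMap (CatOver.app (T.map₂ (totalCell ψ)) (lab α x)) =
      (K.inc i).map ((K.prod α).map fun j => (ψ (c j)).app (x j)) :=
  -- A component of `T.map₂` has the identity as its permutation, so the only symmetry in the action
  -- is ξ at the identity, which `actMap_refl` removes by means of `ξ_refl`. The two tuples are
  -- spelled out so that the images of `lab α x` under T∫F and T∫G are recognised, by unfolding, as
  -- labelled operations in standard form.
  actMap_refl α (x := fun j => (F _).obj (x j)) (y := fun j => (G _).obj (x j))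
    (fun j => (ψ (c j)).app (x j)) _ rfl fun _ => HEq.rfl

/-! ### The lax case. -/

namespace LaxNatTrans

variable {f g : LaxNatTrans H K}

/-- A family of natural transformations is a modification if and only if the corresponding
2-cell of `Cat/I` is an algebra 2-cell. -/
theorem comm_iff (ψ : ∀ i, f.functor i ⟶ g.functor i) :
    (∀ {n : ℕ} {c : Fin n → I} {i : I} (α : T.Hom c i) (x : ∀ j, H.obj (c j)),
      (f.cell α).app x ≫ (ψ i).app ((H.prod α).obj x) =
        (K.prod α).map (fun j => (ψ (c j)).app (x j)) ≫ (g.cell α).app x) ↔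
    f.toLaxMorphism.cell ≫ H.toLaxAlgebra.act ◁ totalCell ψ =
      T.twoMonad.T.map₂ (totalCell ψ) ▷ K.toLaxAlgebra.act ≫ g.toLaxMorphism.cell := by
  -- The action sends `lab α x` to `⟨i, H_α x⟩` by definition, so the whiskered factor is already
  -- the inclusion of `ψ i` at `H_α x`. Only the coherence cell of `f` needs `cellApp_lab`, which
  -- drops the identity transport built into `cellApp`.
  have left {n : ℕ} {c : Fin n → I} {i : I} (α : T.Hom c i) (x : ∀ j, H.obj (c j)) :
      CatOver.app (f.toLaxMorphism.cell ≫ H.toLaxAlgebra.act ◁ totalCell ψ) (lab α x) =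
        (K.inc i).map ((f.cell α).app x ≫ (ψ i).app ((H.prod α).obj x)) :=
    (congrArg (· ≫ _) (cellApp_lab α x)).trans ((K.inc i).map_comp _ _).symm
  -- Here whiskering applies the functor underlying the action of `K` to a component of Tψ, so both
  -- factors have to be computed before they are merged into the image of one composite in the
  -- fibre.
  have right {n : ℕ} {c : Fin n → I} {i : I} (α : T.Hom c i) (x : ∀ j, H.obj (c j)) :
      CatOver.app (T.twoMonad.T.map₂ (totalCell ψ) ▷ K.toLaxAlgebra.act ≫
          g.toLaxMorphism.cell) (lab α x) =
        (K.inc i).map ((K.prod α).map (fun j => (ψ (c j)).app (x j)) ≫ (g.cell α).app x) :=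
    (congrArg₂ (· ≫ ·) (actMap_map₂_totalCell ψ α x) (cellApp_lab α x)).trans
      ((K.inc i).map_comp _ _).symm
  constructor
  · intro h
    -- In a general labelled operation the labels lie over the sources only up to a propositional
    -- equality; `lab_cases` reduces to the form where this holds definitionally, which is where
    -- `left` and `right` apply.
    refine CatOver.hom₂_ext (lab_cases fun α x => ?_)
    exact (left α x).trans ((congrArg (K.inc _).map (h α x)).trans (right α x).symm)
  · intro h n c i α x
    -- Faithfulness of the inclusion turns the equation in the total category back into one in the
    -- fibre over `i`.
    refine (K.inc i).map_injective ((left α x).symm.trans (Eq.trans ?_ (right α x)))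
    rw [h]

/-- Modifications of lax-natural transformations are algebra 2-cells. -/
noncomputable def modificationEquiv (f g : LaxNatTrans H K) :
    Modification f g ≃ TwoMonad.LaxMorphism.TwoCell f.toLaxMorphism g.toLaxMorphism where
  toFun ψ := ⟨totalCell ψ.app, (comm_iff ψ.app).1 ψ.comm⟩
  -- `comm_iff` speaks of 2-cells of the form `totalCell ψ`. The cell of θ has this form only
  -- propositionally, since its fibre components are chosen preimages, so the goal is first
  -- rewritten along the round trip of `totalCellEquiv`.
  invFun θ := ⟨(totalCellEquiv _ _).symm θ.cell, (comm_iff _).2 (by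
    rw [show totalCell ((totalCellEquiv _ _).symm θ.cell) = θ.cell from
      (totalCellEquiv _ _).apply_symm_apply θ.cell]
    exact θ.comm)⟩
  -- Modifications, like algebra 2-cells, are determined by their underlying data, so both round
  -- trips are inherited from `totalCellEquiv`.
  left_inv ψ := Modification.ext ((totalCellEquiv _ _).symm_apply_apply ψ.app)
  right_inv θ := TwoMonad.LaxMorphism.TwoCell.ext ((totalCellEquiv _ _).apply_symm_apply θ.cell)

end LaxNatTrans

/-! ### The colax case. -/

namespace ColaxNatTrans

variable {f g : ColaxNatTrans H K}

/-- A family of natural transformations is a modification if and only if the corresponding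
2-cell of `Cat/I` is an algebra 2-cell. -/
theorem comm_iff (ψ : ∀ i, f.functor i ⟶ g.functor i) :
    (∀ {n : ℕ} {c : Fin n → I} {i : I} (α : T.Hom c i) (x : ∀ j, H.obj (c j)),
      (f.cell α).app x ≫ (K.prod α).map (fun j => (ψ (c j)).app (x j)) =
        (ψ i).app ((H.prod α).obj x) ≫ (g.cell α).app x) ↔
    f.toColaxMorphism.cell ≫ T.twoMonad.T.map₂ (totalCell ψ) ▷ K.toLaxAlgebra.act =
      H.toLaxAlgebra.act ◁ totalCell ψ ≫ g.toColaxMorphism.cell := by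
  -- With the coherence cells reversed, the factor involving the action of `K` now follows the cell
  -- of `f`, so it is this side that needs `actMap_map₂_totalCell`.
  have left {n : ℕ} {c : Fin n → I} {i : I} (α : T.Hom c i) (x : ∀ j, H.obj (c j)) :
      CatOver.app (f.toColaxMorphism.cell ≫
          T.twoMonad.T.map₂ (totalCell ψ) ▷ K.toLaxAlgebra.act) (lab α x) =
        (K.inc i).map ((f.cell α).app x ≫ (K.prod α).map fun j => (ψ (c j)).app (x j)) :=
    (congrArg₂ (· ≫ ·) (cellApp_lab α x) (actMap_map₂_totalCell ψ α x)).trans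
      ((K.inc i).map_comp _ _).symm
  -- The first factor is the inclusion of `ψ i` at `H_α x` by definition; only the cell of `g` has
  -- to be computed.
  have right {n : ℕ} {c : Fin n → I} {i : I} (α : T.Hom c i) (x : ∀ j, H.obj (c j)) :
      CatOver.app (H.toLaxAlgebra.act ◁ totalCell ψ ≫ g.toColaxMorphism.cell) (lab α x) =
        (K.inc i).map ((ψ i).app ((H.prod α).obj x) ≫ (g.cell α).app x) :=
    (congrArg (_ ≫ ·) (cellApp_lab α x)).trans ((K.inc i).map_comp _ _).symm
  constructor
  · intro h
    refine CatOver.hom₂_ext (lab_cases fun α x => ?_)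
    exact (left α x).trans ((congrArg (K.inc _).map (h α x)).trans (right α x).symm)
  · intro h n c i α x
    refine (K.inc i).map_injective ((left α x).symm.trans (Eq.trans ?_ (right α x)))
    rw [h]

/-- Modifications of colax-natural transformations are algebra 2-cells. -/
noncomputable def modificationEquiv (f g : ColaxNatTrans H K) :
    Modification f g ≃ TwoMonad.ColaxMorphism.TwoCell f.toColaxMorphism g.toColaxMorphism where
  toFun ψ := ⟨totalCell ψ.app, (comm_iff ψ.app).1 ψ.comm⟩
  -- `totalCellEquiv` does not involve the coherence cells, so the same inverse serves as in the lax
  -- case.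
  invFun θ := ⟨(totalCellEquiv _ _).symm θ.cell, (comm_iff _).2 (by
    rw [show totalCell ((totalCellEquiv _ _).symm θ.cell) = θ.cell from
      (totalCellEquiv _ _).apply_symm_apply θ.cell]
    exact θ.comm)⟩
  left_inv ψ := Modification.ext ((totalCellEquiv _ _).symm_apply_apply ψ.app)
  right_inv θ := TwoMonad.ColaxMorphism.TwoCell.ext ((totalCellEquiv _ _).apply_symm_apply θ.cell)

end ColaxNatTrans

end LaxOperadMorphism

/-- An algebra 2-cell is determined by its underlying 2-cell, so the clause on `(e ψ).cell` fixes
`e` completely: the specific assignment ψ ↦ ∫ψ is bijective, which says more than that the two sets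
are equinumerous. -/
theorem mainTheorem4 {I : Type u} (T : Operad I) (H K : LaxOperadMorphism T) :
    (∀ f g : LaxOperadMorphism.LaxNatTrans H K,
      ∃ e : LaxOperadMorphism.LaxNatTrans.Modification f g ≃
          TwoMonad.LaxMorphism.TwoCell f.toLaxMorphism g.toLaxMorphism,
        ∀ ψ, (e ψ).cell = LaxOperadMorphism.totalCell ψ.app) ∧
    (∀ f g : LaxOperadMorphism.ColaxNatTrans H K,
      ∃ e : LaxOperadMorphism.ColaxNatTrans.Modification f g ≃
          TwoMonad.ColaxMorphism.TwoCell f.toColaxMorphism g.toColaxMorphism,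
        ∀ ψ, (e ψ).cell = LaxOperadMorphism.totalCell ψ.app) :=
  -- The formula holds by `rfl` because `modificationEquiv` was built with `totalCell` as its
  -- forward map; choice enters only in the inverse.
  ⟨fun f g => ⟨LaxOperadMorphism.LaxNatTrans.modificationEquiv f g, fun _ => rfl⟩,
    fun f g => ⟨LaxOperadMorphism.ColaxNatTrans.modificationEquiv f g, fun _ => rfl⟩⟩
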